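/- Let $d\in\mathbb N$, let $A\in\mathbb R^{d\times d}$ be invertible, and put $\Lambda=A\mathbb Z^d$, $\Lambda^*=A^{-T}\mathbb Z^d$, $V_\Lambda=|\det A|$. Let $x,y\in\mathbb R^d$. For $\nu\in\mathbb C$ define the upper Crandall function by $$G_\nu(z)=\frac{\Gamma(\nu/2,\pi |z|^2)}{(\pi |z|^2)^{\nu/2}}\quad (z\in\mathbb R^d\setminus\{0\}),\qquad G_\nu(0)=-\frac2\nu ,$$ where $\Gamma(s,u)=\int_u^\infty t^{s-1}e^{-t}\,dt$ ($s\in\mathbb C$, $u>0$) is the upper incomplete gamma function. (a) The Epstein zeta function is well-defined: the lattice sum $$\sum_{z\in\Lambda,\ z\ne x}\frac{e^{-2\pi i\,y\cdot z}}{|x-z|^{\nu}}$$ converges absolutely for $\operatorname{Re}\nu>d$ and has a unique meromorphic continuation $\nu\mapsto Z_{\Lambda,\nu}(x;y)$ to $\mathbb C$ (removable singularities being removed, and with the value $0$ assigned at poles by convention), which is holomorphic at every $\nu\in\mathbb C$, except possibly at $\nu=d$ in the case $y\in\Lambda^*$. (b) Let $\lambda>0$ and $\nu\in\mathbb C$,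 with $\nu\neq d$ if $y\in\Lambda^*$. Then $$Z_{\Lambda,\nu}(x;y)=\frac{(\lambda^2/\pi)^{-\nu/2}}{\Gamma(\nu/2)}\left[\sum_{z\in\Lambda}G_\nu\!\left(\frac{z-x}{\lambda}\right)e^{-2\pi i\,y\cdot z}+\frac{\lambda^d}{V_\Lambda}\sum_{k\in\Lambda^*}G_{d-\nu}\big(\lambda(k+y)\big)e^{-2\pi i\,x\cdot(k+y)}\right],$$ where $1/\Gamma(\nu/2)=0$ for $\nu\in\{0,-2,-4,\dots\}$ and where, for $\nu=0$ and $x\in\Lambda$, the right-hand side has a removable singularity and is understood as its limit as $\nu\to0$, $\nu\ne 0$. Both sums (at $\nu=0$ with $x\in\Lambda$, up to the single term $z=x$) converge superexponentially: they converge absolutely, and there are constants $C$ and $c>0$ (which may depend on all the data) such that for all $r\ge0$ the sum of the absolute values of the terms with $|z|>r$, respectively $|k|>r$, is at most $Ce^{-cr^2}$. -/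

import Mathlib

open Filter Topology

noncomputable section

/-- The lattice `Λ = A ℤ^d ⊆ ℝ^d` (with `ℝ^d` carrying the Euclidean norm). -/
def latticeOf {d : ℕ} (A : Matrix (Fin d) (Fin d) ℝ) : Set (EuclideanSpace ℝ (Fin d)) :=
  {z | ∃ n : Fin d → ℤ, z = WithLp.toLp 2 (A.mulVec fun i => (n i : ℝ))}

/-- The reciprocal lattice `Λ* = A^{-T} ℤ^d`. -/
def reciprocalLatticeOf {d : ℕ} (A : Matrix (Fin d) (Fin d) ℝ) :
    Set (EuclideanSpace ℝ (Fin d)) :=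
  latticeOf (A⁻¹).transpose

/-- The volume `V_Λ = |det A|` of the elementary lattice cell. -/
def cellVolume {d : ℕ} (A : Matrix (Fin d) (Fin d) ℝ) : ℝ := |A.det|

/-- The summand `e^{-2πi y·z} / |x - z|^ν`. -/
def epsteinTerm {d : ℕ} (x y : EuclideanSpace ℝ (Fin d)) (ν : ℂ)
    (z : EuclideanSpace ℝ (Fin d)) : ℂ :=
  Complex.exp (-2 * Real.pi * Complex.I * (inner ℝ y z : ℝ)) / ((‖x - z‖ : ℝ) : ℂ) ^ ν

/-- The primed lattice sum over all `z ∈ Λ` with `z ≠ x`. -/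
def epsteinLatticeSum {d : ℕ} (A : Matrix (Fin d) (Fin d) ℝ)
    (x y : EuclideanSpace ℝ (Fin d)) (ν : ℂ) : ℂ :=
  ∑' z : ↥(latticeOf A \ {x}), epsteinTerm x y ν z

/-- `Z` is a meromorphic continuation to `ℂ` of the lattice sum on `Re ν > d`.
Being in normal form means that `Z` is meromorphic, takes the analytic value wherever the
singularity is removable, and takes the value `0` at the poles. -/
def IsEpsteinContinuation {d : ℕ} (A : Matrix (Fin d) (Fin d) ℝ)
    (x y : EuclideanSpace ℝ (Fin d)) (Z : ℂ → ℂ) : Prop :=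
  MeromorphicNFOn Z Set.univ ∧
    ∀ ν : ℂ, (d : ℝ) < ν.re → Z ν = epsteinLatticeSum A x y ν

/-- The Epstein zeta function `ν ↦ Z_{Λ,ν}(x; y)`: the meromorphic continuation of the
lattice sum. -/
def epsteinZeta {d : ℕ} (A : Matrix (Fin d) (Fin d) ℝ)
    (x y : EuclideanSpace ℝ (Fin d)) : ℂ → ℂ :=
  Classical.epsilon (IsEpsteinContinuation A x y)

/-- The upper incomplete gamma function `Γ(s, u) = ∫_u^∞ t^{s-1} e^{-t} dt`, for `s ∈ ℂ`
and real `u > 0` (where the integral converges for every `s` and is entire in `s`). -/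
def upperIncompleteGamma (s : ℂ) (u : ℝ) : ℂ :=
  ∫ t in Set.Ioi u, (t : ℂ) ^ (s - 1) * Complex.exp (-(t : ℂ))

open Classical in
/-- The upper Crandall function: `G_ν(z) = Γ(ν/2, π z²) / (π z²)^{ν/2}` for `z ≠ 0`, and
`G_ν(0) = -2/ν`. -/
def upperCrandall {d : ℕ} (ν : ℂ) (z : EuclideanSpace ℝ (Fin d)) : ℂ :=
  if z = 0 then -2 / ν
  else upperIncompleteGamma (ν / 2) (Real.pi * ‖z‖ ^ 2) /
    ((Real.pi * ‖z‖ ^ 2 : ℝ) : ℂ) ^ (ν / 2)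

/-- The summand `G_ν((z - x)/lam) e^{-2πi y·z}` of the sum over `Λ`. -/
def crandallTerm {d : ℕ} (x y : EuclideanSpace ℝ (Fin d)) (lam : ℝ) (ν : ℂ)
    (z : EuclideanSpace ℝ (Fin d)) : ℂ :=
  upperCrandall ν (lam⁻¹ • (z - x)) *
    Complex.exp (-2 * Real.pi * Complex.I * (inner ℝ y z : ℝ))

/-- The summand `G_{d-ν}(lam (k + y)) e^{-2πi x·(k + y)}` of the sum over `Λ*`. -/
def crandallDualTerm {d : ℕ} (x y : EuclideanSpace ℝ (Fin d)) (lam : ℝ) (ν : ℂ)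
    (k : EuclideanSpace ℝ (Fin d)) : ℂ :=
  upperCrandall ((d : ℂ) - ν) (lam • (k + y)) *
    Complex.exp (-2 * Real.pi * Complex.I * (inner ℝ x (k + y) : ℝ))

/-- The right-hand side of Crandall's representation with splitting parameter `lam`. -/
def crandallRepresentation {d : ℕ} (A : Matrix (Fin d) (Fin d) ℝ)
    (x y : EuclideanSpace ℝ (Fin d)) (lam : ℝ) (ν : ℂ) : ℂ :=
  ((lam ^ 2 / Real.pi : ℝ) : ℂ) ^ (-ν / 2) / Complex.Gamma (ν / 2) *
    ((∑' z : ↥(latticeOf A), crandallTerm x y lam ν z) +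
      ((lam ^ d / cellVolume A : ℝ) : ℂ) *
        ∑' k : ↥(reciprocalLatticeOf A), crandallDualTerm x y lam ν k)

/-- Superexponential convergence of `∑_{z ∈ S} f z`: the sum converges absolutely, and the
remainder outside the ball of radius `r` is at most `C e^{-c r²}` for constants `C` and `c > 0`
independent of `r`. -/
def SuperexponentiallyConvergent {d : ℕ} (S : Set (EuclideanSpace ℝ (Fin d)))
    (f : EuclideanSpace ℝ (Fin d) → ℂ) : Prop :=
  (Summable fun z : ↥S => ‖f z‖) ∧
    ∃ C c : ℝ, 0 < c ∧ ∀ r : ℝ, 0 ≤ r →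
      ∑' z : ↥(S ∩ {z | r < ‖z‖}), ‖f z‖ ≤ C * Real.exp (-c * r ^ 2)

end

/-!
The Epstein zeta function is the Mellin transform of a lattice theta series, and Crandall's formula
is Riemann's splitting of that Mellin transform at a point fixed by `lam`.

For a family of coefficients `a i` and radii `r i ≥ 0` consider `θ(t) = ∑ a i e^{-π (r i)² t}`,
summed over `r i ≠ 0`. Substituting `u = π ρ² t` in the incomplete gamma function gives
`G_ν(ρ) = ∫_1^∞ t^{ν/2-1} e^{-π ρ² t} dt`, so a sum of terms `a i G_ν(r i)` is the part over
`(1, ∞)` of the Mellin transform of `θ`. That part is entire in `ν`, because the gap between `0` and the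
positive radii makes `θ` decay exponentially; the value `G_ν(0) = -2/ν` accounts for the terms of
radius `0` (`GaussianSummable.hasSum_crandallProfile`). For `Re ν > d` the full Mellin transform of
`θ` is the completed zeta function (`mellin_puncturedTheta_direct`). The part over `(0, 1)` is
carried to `(1, ∞)` by the functional equation between the theta series of `Λ` with radii
`|z - x| / lam` and that of `Λ*` with radii `lam |k + y|`
(`scaled_theta_functional_equation`, `GaussianSummable.mellin_puncturedTheta`). The functional
equation is Poisson summation (`tsum_int_eq_tsum_fourier`), obtained from Fourier series on the
torus `ℝ^d / ℤ^d`, applied to a Gaussian.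

This proves Crandall's formula for `Re ν > d`. Its right-hand side is meromorphic on `ℂ`: the only
apparent poles are at `ν = d`, which is absent unless `y ∈ Λ*`, and at `ν = 0`, which disappears
since `-2 / (ν Γ(ν/2)) = -1 / Γ(ν/2 + 1)`. With that term rewritten the right-hand side
(`regularizedCrandall`) is, in normal form, the meromorphic continuation for every `lam`, and the
continuation is unique by the identity theorem (`MeromorphicNFOn.eq_of_eventuallyEq`).
-/

/-! ### Poisson summation over `ℤ^ι` -/

open MeasureTheory in
/-- The integral over `ℝ^ι` of a continuous function, unfolded along the integer translates of
the unit cube. -/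
theorem integral_cube_tsum_translates {ι : Type*} [Fintype ι] {h : (ι → ℝ) → ℂ}
    (hc : Continuous h) {u : (ι → ℤ) → ℝ} (hu : Summable u)
    (hb : ∀ v : ι → ℝ, ‖v‖ ≤ 1 → ∀ m : ι → ℤ, ‖h (v + fun i => (m i : ℝ))‖ ≤ u m) :
    ∫ v in {v : ι → ℝ | ∀ i, v i ∈ Set.Ioc (0 : ℝ) (0 + 1)}, ∑' m : ι → ℤ,
      h (v + fun i => (m i : ℝ)) = ∫ v, h v := by
  set Q : (ι → ℤ) → Set (ι → ℝ) := fun m => {v | ∀ i, v i ∈ Set.Ioc (m i : ℝ) (m i + 1)} with hQ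
  set Q₀ : Set (ι → ℝ) := {v : ι → ℝ | ∀ i, v i ∈ Set.Ioc (0 : ℝ) (0 + 1)} with hQ₀
  have hpi (a : ι → ℝ) : {v : ι → ℝ | ∀ i, v i ∈ Set.Ioc (a i) (a i + 1)} =
      Set.univ.pi fun i => Set.Ioc (a i) (a i + 1) := by ext v; simp
  have hQm m : MeasurableSet (Q m) := by
    simp only [hQ]
    rw [hpi]
    exact MeasurableSet.univ_pi fun i => measurableSet_Ioc
  have hQ₀m : MeasurableSet Q₀ := by
    simp only [hQ₀]
    rw [hpi fun _ => 0]
    exact MeasurableSet.univ_pi fun i => measurableSet_Ioc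
  have hvol : volume Q₀ = 1 := by
    simp only [hQ₀]
    rw [hpi fun _ => 0, volume_pi_pi]
    simp
  have hfin : IsFiniteMeasure (volume.restrict Q₀) := ⟨by simp [hvol]⟩
  have hnorm : ∀ v ∈ Q₀, ‖v‖ ≤ 1 := fun v hv => by
    refine (pi_norm_le_iff_of_nonneg zero_le_one).2 fun i => ?_
    have := hv i
    rw [Real.norm_eq_abs, abs_le]
    constructor <;> linarith [this.1, this.2]
  have hpre (m : ι → ℤ) : (fun v => v + fun i => (m i : ℝ)) ⁻¹' Q m = Q₀ := by
    ext v
    simp only [hQ, hQ₀, Set.mem_preimage, Set.mem_ofPred_eq, Pi.add_apply, Set.mem_Ioc]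
    refine forall_congr' fun i => ?_
    constructor <;> rintro ⟨h1, h2⟩ <;> constructor <;> linarith
  have htr {E : Type} [NormedAddCommGroup E] [NormedSpace ℝ E] (g : (ι → ℝ) → E) (m : ι → ℤ) :
      ∫ v in Q₀, g (v + fun i => (m i : ℝ)) = ∫ v in Q m, g v := by
    rw [← hpre m]
    exact (measurePreserving_add_right volume _).setIntegral_preimage_emb
      (MeasurableEquiv.addRight fun i => (m i : ℝ)).measurableEmbedding g (Q m)
  have hcm (m : ι → ℤ) : Continuous fun v : ι → ℝ => h (v + fun i => (m i : ℝ)) := by fun_prop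
  have hint (m : ι → ℤ) : Integrable (fun v => h (v + fun i => (m i : ℝ))) (volume.restrict Q₀) :=
    Integrable.of_bound (hcm m).aestronglyMeasurable (u m)
      ((ae_restrict_iff' hQ₀m).2 (.of_forall fun v hv => hb v (hnorm v hv) m))
  have hle (m : ι → ℤ) : ∫ v in Q₀, ‖h (v + fun i => (m i : ℝ))‖ ≤ u m := by
    refine (integral_mono_ae (hint m).norm (integrable_const (u m))
      ((ae_restrict_iff' hQ₀m).2 (.of_forall fun v hv => hb v (hnorm v hv) m))).trans ?_
    simp [Measure.real, hvol]
  have hsum : Summable fun m : ι → ℤ => ∫ v in Q₀, ‖h (v + fun i => (m i : ℝ))‖ :=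
    hu.of_nonneg_of_le (fun m => integral_nonneg fun _ => norm_nonneg _) hle
  have hdisj : Pairwise (Function.onFun Disjoint Q) := by
    intro m n hmn
    refine Set.disjoint_left.2 fun v hv hv' => hmn (funext fun i => ?_)
    have h1 := hv i
    have h2 := hv' i
    have h3 : (m i : ℝ) < n i + 1 := h1.1.trans_le h2.2
    have h4 : (n i : ℝ) < m i + 1 := h2.1.trans_le h1.2
    norm_cast at h3 h4
    omega
  have hcover : ⋃ m, Q m = Set.univ := by
    refine Set.eq_univ_of_forall fun v => Set.mem_iUnion.2 ⟨fun i => ⌈v i⌉ - 1, fun i => ?_⟩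
    have h1 := Int.ceil_lt_add_one (v i)
    have h2 := Int.le_ceil (v i)
    push_cast
    constructor <;> linarith
  have hintQ (m : ι → ℤ) : IntegrableOn h (Q m) := by
    have := (measurePreserving_add_right volume fun i => (m i : ℝ)).integrableOn_comp_preimage
      (MeasurableEquiv.addRight fun i => (m i : ℝ)).measurableEmbedding (f := h) (s := Q m)
    rw [← this, hpre]
    exact hint m
  have hall : IntegrableOn h (⋃ m, Q m) :=
    integrableOn_iUnion_of_summable_integral_norm hintQ (by
      simpa only [htr (fun v => ‖h v‖)] using hsum)
  have h1 := hasSum_integral_of_summable_integral_norm hint hsum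
  have h2 := hasSum_integral_iUnion hQm hdisj hall
  simp only [htr h] at h1
  rw [hcover, setIntegral_univ] at h2
  exact h1.unique h2

/-- A continuous `ℤ^ι`-periodic function descends to the torus. -/
theorem exists_torus_lift {ι : Type*} [Fintype ι] {F : (ι → ℝ) → ℂ} (hF : Continuous F)
    (hper : ∀ (v : ι → ℝ) (n : ι → ℤ), F (v + fun i => (n i : ℝ)) = F v) :
    ∃ g : C(UnitAddTorus ι, ℂ), ∀ v : ι → ℝ, g (fun i => (v i : UnitAddCircle)) = F v := by
  have hq : IsOpenQuotientMap (Pi.map fun (_ : ι) (t : ℝ) => (t : UnitAddCircle)) :=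
    IsOpenQuotientMap.piMap fun _ => QuotientAddGroup.isOpenQuotientMap_mk
  let q : C(ι → ℝ, UnitAddTorus ι) := ⟨_, hq.continuous⟩
  have hq' : IsQuotientMap q := hq.isQuotientMap
  have hfac : Function.FactorsThrough (⟨F, hF⟩ : C(ι → ℝ, ℂ)) q := by
    intro v w hvw
    have (i : ι) : ∃ n : ℤ, w i + n = v i := by
      have h : ((v i : ℝ) : UnitAddCircle) = (w i : ℝ) := congrFun hvw i
      obtain ⟨n, hn⟩ := AddSubgroup.mem_zmultiples_iff.1 (QuotientAddGroup.eq.1 h.symm)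
      exact ⟨n, by simp at hn; linarith⟩
    choose n hn using this
    have : v = w + fun i => (n i : ℝ) := funext fun i => (hn i).symm
    simp only [ContinuousMap.coe_mk, this, hper]
  exact ⟨hq'.lift _ hfac, fun v => DFunLike.congr_fun (hq'.lift_comp _ hfac) v⟩

/-- **Poisson summation** over `ℤ^ι`, for continuous functions whose integer translates are
uniformly summable on bounded sets and whose Fourier transform is summable on `ℤ^ι`. -/
theorem tsum_int_eq_tsum_fourier {ι : Type*} [Fintype ι] {f : (ι → ℝ) → ℂ} (hc : Continuous f)
    (hb : ∀ R : ℝ, ∃ u : (ι → ℤ) → ℝ, Summable u ∧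
      ∀ v : ι → ℝ, ‖v‖ ≤ R → ∀ m : ι → ℤ, ‖f (v + fun i => (m i : ℝ))‖ ≤ u m)
    (hF : Summable fun n : ι → ℤ =>
      ∫ v, Complex.exp (-2 * Real.pi * Complex.I * (∑ i, n i * v i : ℝ)) * f v) :
    ∑' n : ι → ℤ, f (fun i => (n i : ℝ)) = ∑' n : ι → ℤ,
      ∫ v, Complex.exp (-2 * Real.pi * Complex.I * (∑ i, n i * v i : ℝ)) * f v := by
  have hcont : Continuous fun v => ∑' m : ι → ℤ, f (v + fun i => (m i : ℝ)) := by
    refine continuous_iff_continuousAt.2 fun v => ?_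
    obtain ⟨u, hu, hfu⟩ := hb (‖v‖ + 1)
    have : ContinuousOn (fun v => ∑' m : ι → ℤ, f (v + fun i => (m i : ℝ)))
        (Metric.ball v 1) :=
      continuousOn_tsum (fun m => Continuous.continuousOn (by fun_prop)) hu fun m w hw =>
        hfu w (by
          have := norm_le_norm_add_norm_sub' w v
          rw [mem_ball_iff_norm] at hw
          linarith) m
    exact this.continuousAt (Metric.ball_mem_nhds v one_pos)
  obtain ⟨g, hg⟩ := exists_torus_lift hcont fun v n => by
    rw [← (Equiv.addLeft n).tsum_eq fun m : ι → ℤ => f (v + fun i => (m i : ℝ))]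
    refine tsum_congr fun m => congrArg f (funext fun i => ?_)
    simp [add_assoc]
  have hchar (n : ι → ℤ) (v : ι → ℝ) :
      UnitAddTorus.mFourier (-n) (fun i => (v i : UnitAddCircle)) =
        Complex.exp (-2 * Real.pi * Complex.I * (∑ i, n i * v i : ℝ)) := by
    simp only [UnitAddTorus.mFourier, ContinuousMap.coe_mk, fourier_coe_apply, ← Complex.exp_sum]
    congr 1
    push_cast
    rw [Finset.mul_sum]
    exact Finset.sum_congr rfl fun i _ => by simp only [Pi.neg_apply]; push_cast; ring
  have hcoeff (n : ι → ℤ) : UnitAddTorus.mFourierCoeff g n =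
      ∫ v, Complex.exp (-2 * Real.pi * Complex.I * (∑ i, n i * v i : ℝ)) * f v := by
    obtain ⟨u, hu, hfu⟩ := hb 1
    rw [UnitAddTorus.mFourierCoeff_eq_integral g n 0, ← integral_cube_tsum_translates
      (h := fun v => Complex.exp (-2 * Real.pi * Complex.I * (∑ i, n i * v i : ℝ)) * f v)
      (by fun_prop) hu]
    · simp only [hchar, hg, Pi.zero_apply, smul_eq_mul]
      refine MeasureTheory.integral_congr_ae (.of_forall fun v => ?_)
      dsimp only
      rw [← tsum_mul_left]
      refine tsum_congr fun m => ?_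
      congr 1
      -- the character `v ↦ e^{-2πi n·v}` is invariant under integer translations
      refine Complex.exp_eq_exp_iff_exists_int.2 ⟨∑ i, n i * m i, ?_⟩
      push_cast
      simp only [Pi.add_apply, mul_add, Finset.sum_add_distrib, Complex.ofReal_add]
      push_cast
      ring
    · intro v hv m
      have : ‖Complex.exp (-2 * Real.pi * Complex.I *
          (∑ i, n i * (v + fun i => (m i : ℝ)) i : ℝ))‖ = 1 := by
        rw [Complex.norm_exp]
        simp
      rw [norm_mul, this, one_mul]
      exact hfu v hv m
  have key := UnitAddTorus.hasSum_mFourier_series_apply_of_summable (f := g)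
    (by simpa only [funext hcoeff] using hF) 0
  have h0 : g 0 = ∑' n : ι → ℤ, f (fun i => (n i : ℝ)) := by
    simpa [← Pi.zero_def] using hg 0
  rw [← h0, ← key.tsum_eq]
  refine tsum_congr fun n => ?_
  have h1 : UnitAddTorus.mFourier n (0 : UnitAddTorus ι) = 1 := by
    simpa [← Pi.zero_def] using hchar (-n) 0
  rw [h1, hcoeff, smul_eq_mul, mul_one]

/-! ### Theta series and their Mellin transforms -/

/-- A family of coefficients `a i` and radii `r i ≥ 0`, of which the positive ones are bounded away
from `0`, with `∑ |a i| e^{-c (r i)²} < ∞` for all `c > 0`. -/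
structure GaussianSummable {ι : Type*} (a : ι → ℂ) (r : ι → ℝ) : Prop where
  nonneg : ∀ i, 0 ≤ r i
  summable : ∀ c : ℝ, 0 < c → Summable fun i => ‖a i‖ * Real.exp (-c * r i ^ 2)
  gap : ∃ δ : ℝ, 0 < δ ∧ ∀ i, r i = 0 ∨ δ ≤ r i

/-- The term of radius `rho` in the theta series, `e^{-π rho² t}`, and `0` when `rho = 0`. -/
noncomputable def puncturedGaussian (rho t : ℝ) : ℝ :=
  if rho = 0 then 0 else Real.exp (-Real.pi * rho ^ 2 * t)

/-- The theta series `∑ a i e^{-π (r i)² t}` over the indices with `r i ≠ 0`. -/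
noncomputable def puncturedTheta {ι : Type*} (a : ι → ℂ) (r : ι → ℝ) (t : ℝ) : ℂ :=
  ∑' i, a i * puncturedGaussian (r i) t

/-- The total coefficient of the terms of radius `0`. -/
noncomputable def zeroCoeff {ι : Type*} (a : ι → ℂ) (r : ι → ℝ) : ℂ :=
  ∑' i, if r i = 0 then a i else 0

/-- The part `∫_1^∞ t^{s-1} θ(t) dt` of the Mellin transform of the punctured theta series. -/
noncomputable def upperMellin {ι : Type*} (a : ι → ℂ) (r : ι → ℝ) (s : ℂ) : ℂ :=
  mellin (Set.indicator (Set.Ioi 1) (puncturedTheta a r)) s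

open Classical in
/-- The upper Crandall function as a function of the norm of its argument. -/
noncomputable def crandallProfile (ν : ℂ) (rho : ℝ) : ℂ :=
  if rho = 0 then -2 / ν
  else upperIncompleteGamma (ν / 2) (Real.pi * rho ^ 2) /
    ((Real.pi * rho ^ 2 : ℝ) : ℂ) ^ (ν / 2)

theorem upperCrandall_eq_crandallProfile {d : ℕ} (ν : ℂ) (z : EuclideanSpace ℝ (Fin d)) :
    upperCrandall ν z = crandallProfile ν ‖z‖ := by
  simp only [upperCrandall, crandallProfile, norm_eq_zero]

theorem puncturedGaussian_nonneg (rho t : ℝ) : 0 ≤ puncturedGaussian rho t := by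
  unfold puncturedGaussian; split_ifs <;> positivity

theorem continuous_puncturedGaussian (rho : ℝ) : Continuous (puncturedGaussian rho) := by
  unfold puncturedGaussian; split_ifs <;> fun_prop

/-- For `t ≥ 1`, a Gaussian of radius at least `δ` is at most a Gaussian in the radius times an
exponentially decaying function of `t`. -/
theorem puncturedGaussian_le {δ rho t : ℝ} (hδ : 0 < δ) (hrho : rho = 0 ∨ δ ≤ rho) (ht : 1 ≤ t) :
    puncturedGaussian rho t ≤
      Real.exp (-(Real.pi / 2) * rho ^ 2) * Real.exp (-(Real.pi / 2 * δ ^ 2) * t) := by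
  unfold puncturedGaussian
  split_ifs with h
  · positivity
  · have h1 : δ ^ 2 ≤ rho ^ 2 := pow_le_pow_left₀ hδ.le (hrho.resolve_left h) 2
    rw [← Real.exp_add, Real.exp_le_exp]
    have h2 : rho ^ 2 ≤ rho ^ 2 * t := le_mul_of_one_le_right (sq_nonneg _) ht
    have h3 : δ ^ 2 * t ≤ rho ^ 2 * t := mul_le_mul_of_nonneg_right h1 (by linarith)
    have h4 := mul_le_mul_of_nonneg_left (add_le_add h2 h3) Real.pi_pos.le
    linarith

/-- `G_ν` as a Mellin-type integral over `(1, ∞)` of a Gaussian. -/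
theorem crandallProfile_eq_integral (ν : ℂ) {rho : ℝ} (hrho : 0 < rho) :
    crandallProfile ν rho =
      ∫ t in Set.Ioi (1 : ℝ), (t : ℂ) ^ (ν / 2 - 1) * (puncturedGaussian rho t : ℂ) := by
  have hb : 0 < Real.pi * rho ^ 2 := by positivity
  set b := Real.pi * rho ^ 2 with hb'
  have h := MeasureTheory.integral_comp_mul_left_Ioi
    (fun u : ℝ => (u : ℂ) ^ (ν / 2 - 1) * Complex.exp (-(u : ℂ))) 1 hb
  rw [mul_one] at h
  have hbc : (b : ℂ) ≠ 0 := Complex.ofReal_ne_zero.2 hb.ne'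
  have h2 : upperIncompleteGamma (ν / 2) b =
      (b : ℂ) * ∫ t in Set.Ioi (1 : ℝ),
        ((b * t : ℝ) : ℂ) ^ (ν / 2 - 1) * Complex.exp (-((b * t : ℝ) : ℂ)) := by
    rw [h, upperIncompleteGamma, Complex.real_smul, Complex.ofReal_inv, mul_inv_cancel_left₀ hbc]
  rw [crandallProfile, if_neg hrho.ne', ← hb', h2, mul_div_assoc, mul_comm, ← mul_div_right_comm,
    mul_div_assoc, ← MeasureTheory.integral_mul_const]
  refine MeasureTheory.setIntegral_congr_fun measurableSet_Ioi fun t ht => ?_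
  have ht0 : (0 : ℝ) < t := zero_lt_one.trans ht
  simp only [puncturedGaussian, if_neg hrho.ne']
  rw [Complex.ofReal_mul, Complex.mul_cpow_ofReal_nonneg hb.le ht0.le, Complex.cpow_sub _ _ hbc,
    Complex.cpow_one, Complex.ofReal_exp]
  have hbp : (b : ℂ) ^ (ν / 2) ≠ 0 := by simp [Complex.cpow_eq_zero_iff, hbc]
  have : (-((b : ℂ) * t)) = ((-Real.pi * rho ^ 2 * t : ℝ) : ℂ) := by
    rw [hb']; push_cast; ring
  rw [this]
  field_simp

theorem integrableOn_rpow_mul_exp_neg (σ : ℝ) {b : ℝ} (hb : 0 < b) :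
    MeasureTheory.IntegrableOn (fun t : ℝ => t ^ σ * Real.exp (-b * t)) (Set.Ioi 1) := by
  refine integrable_of_isBigO_exp_neg (b := b / 2) (by positivity) ?_ ?_
  · intro t ht
    have : t ≠ 0 := (zero_lt_one.trans_le ht).ne'
    exact ((Real.continuousAt_rpow_const _ _ (.inl this)).mul (by fun_prop)).continuousWithinAt
  · have h := (isLittleO_rpow_exp_pos_mul_atTop σ (half_pos hb)).isBigO
    have h2 := h.mul (Asymptotics.isBigO_refl (fun t : ℝ => Real.exp (-b * t)) atTop)
    refine h2.congr_right fun t => ?_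
    rw [← Real.exp_add]
    congr 1
    ring

theorem isBigO_indicator_Ioi_one_nhdsGT (f : ℝ → ℂ) (b : ℝ) :
    Set.indicator (Set.Ioi 1) f =O[𝓝[>] 0] fun t : ℝ => t ^ (-b) := by
  refine Asymptotics.IsBigO.of_bound 1 ?_
  filter_upwards [nhdsWithin_le_nhds (Iio_mem_nhds (zero_lt_one' ℝ))] with t ht
  rw [Set.indicator_of_notMem (by simpa using (Set.mem_Iio.1 ht).le)]
  simp only [norm_zero]
  positivity

namespace GaussianSummable

variable {ι : Type*} {a : ι → ℂ} {r : ι → ℝ}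

theorem summable_puncturedGaussian (h : GaussianSummable a r) {t : ℝ} (ht : 0 < t) :
    Summable fun i => a i * (puncturedGaussian (r i) t : ℂ) := by
  refine .of_norm ((h.summable (Real.pi * t) (by positivity)).of_nonneg_of_le
    (fun _ => norm_nonneg _) fun i => ?_)
  rw [norm_mul, Complex.norm_real, Real.norm_of_nonneg (puncturedGaussian_nonneg _ _)]
  gcongr
  unfold puncturedGaussian
  split_ifs
  · positivity
  · exact le_of_eq (congrArg _ (by ring))

theorem summable_zeroCoeff (h : GaussianSummable a r) :
    Summable fun i => if r i = 0 then a i else 0 := by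
  refine .of_norm ((h.summable 1 one_pos).of_nonneg_of_le (fun _ => norm_nonneg _) fun i => ?_)
  split_ifs with hi
  · simp [hi]
  · rw [norm_zero]; positivity

/-- The full theta series is the punctured one plus the constant contributed by radius `0`. -/
theorem tsum_gaussian (h : GaussianSummable a r) {t : ℝ} (ht : 0 < t) :
    ∑' i, a i * (Real.exp (-Real.pi * r i ^ 2 * t) : ℂ) = puncturedTheta a r t + zeroCoeff a r := by
  rw [puncturedTheta, zeroCoeff, ← (h.summable_puncturedGaussian ht).tsum_add h.summable_zeroCoeff]
  refine tsum_congr fun i => ?_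
  unfold puncturedGaussian
  split_ifs with hi <;> simp [hi]

theorem exists_norm_puncturedTheta_le (h : GaussianSummable a r) :
    ∃ K b : ℝ, 0 < b ∧ ∀ t, 1 ≤ t → ‖puncturedTheta a r t‖ ≤ K * Real.exp (-b * t) := by
  obtain ⟨δ, hδ, hgap⟩ := h.gap
  refine ⟨∑' i, ‖a i‖ * Real.exp (-(Real.pi / 2) * r i ^ 2), Real.pi / 2 * δ ^ 2, by positivity,
    fun t ht => ?_⟩
  rw [← tsum_mul_right]
  refine tsum_of_norm_bounded ((h.summable _ (by positivity)).mul_right _).hasSum fun i => ?_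
  rw [norm_mul, Complex.norm_real, Real.norm_of_nonneg (puncturedGaussian_nonneg _ _), mul_assoc]
  gcongr
  exact puncturedGaussian_le hδ (hgap i) ht

theorem continuousOn_puncturedTheta (h : GaussianSummable a r) :
    ContinuousOn (puncturedTheta a r) (Set.Ici 1) := by
  obtain ⟨δ, hδ, hgap⟩ := h.gap
  refine continuousOn_tsum (u := fun i => ‖a i‖ * Real.exp (-(Real.pi / 2) * r i ^ 2))
    (fun i => ?_) (h.summable _ (by positivity)) fun i t ht => ?_
  · exact (continuous_const.mul
      (Complex.continuous_ofReal.comp (continuous_puncturedGaussian _))).continuousOn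
  · rw [norm_mul, Complex.norm_real, Real.norm_of_nonneg (puncturedGaussian_nonneg _ _)]
    gcongr
    refine (puncturedGaussian_le hδ (hgap i) ht).trans (mul_le_of_le_one_right (by positivity) ?_)
    have ht0 : (0 : ℝ) ≤ t := zero_le_one.trans ht
    refine Real.exp_le_one_iff.2 ?_
    have : 0 ≤ Real.pi / 2 * δ ^ 2 * t := by positivity
    linarith

theorem locallyIntegrableOn_indicator (h : GaussianSummable a r) :
    MeasureTheory.LocallyIntegrableOn (Set.indicator (Set.Ioi 1) (puncturedTheta a r))
      (Set.Ioi 0) := by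
  obtain ⟨K, b, hb, hK⟩ := h.exists_norm_puncturedTheta_le
  have hint : MeasureTheory.IntegrableOn (puncturedTheta a r) (Set.Ioi 1) := by
    refine ((integrableOn_rpow_mul_exp_neg 0 hb).const_mul K).mono'
      ((h.continuousOn_puncturedTheta.mono Set.Ioi_subset_Ici_self).aestronglyMeasurable
        measurableSet_Ioi)
      ((MeasureTheory.ae_restrict_iff' measurableSet_Ioi).2 (.of_forall fun t ht => ?_))
    rw [Real.rpow_zero, one_mul]
    exact hK t (Set.mem_Ioi.1 ht).le
  exact ((MeasureTheory.integrable_indicator_iff measurableSet_Ioi).2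
    hint).locallyIntegrable.locallyIntegrableOn _

theorem isBigO_indicator_atTop (h : GaussianSummable a r) :
    ∃ b : ℝ, 0 < b ∧ Set.indicator (Set.Ioi 1) (puncturedTheta a r) =O[atTop]
      fun t => Real.exp (-b * t) := by
  obtain ⟨K, b, hb, hK⟩ := h.exists_norm_puncturedTheta_le
  refine ⟨b, hb, Asymptotics.IsBigO.of_bound K ((eventually_gt_atTop 1).mono fun t ht => ?_)⟩
  rw [Real.norm_of_nonneg (Real.exp_pos _).le, Set.indicator_of_mem (Set.mem_Ioi.2 ht)]
  exact hK t ht.le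

theorem mellinConvergent_indicator (h : GaussianSummable a r) (s : ℂ) :
    MellinConvergent (Set.indicator (Set.Ioi 1) (puncturedTheta a r)) s := by
  obtain ⟨b, hb, hO⟩ := h.isBigO_indicator_atTop
  exact mellinConvergent_of_isBigO_rpow_exp hb h.locallyIntegrableOn_indicator hO
    (isBigO_indicator_Ioi_one_nhdsGT _ _) (sub_one_lt s.re)

theorem differentiable_upperMellin (h : GaussianSummable a r) :
    Differentiable ℂ (upperMellin a r) := fun s => by
  obtain ⟨b, hb, hO⟩ := h.isBigO_indicator_atTop
  exact mellin_differentiableAt_of_isBigO_rpow_exp hb h.locallyIntegrableOn_indicator hO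
    (isBigO_indicator_Ioi_one_nhdsGT _ _) (sub_one_lt s.re)

end GaussianSummable

/-- `G_ν` decays like a Gaussian, uniformly on `{0} ∪ [δ, ∞)`. -/
theorem exists_norm_crandallProfile_le (ν : ℂ) {δ : ℝ} (hδ : 0 < δ) :
    ∃ K : ℝ, ∀ rho : ℝ, rho = 0 ∨ δ ≤ rho →
      ‖crandallProfile ν rho‖ ≤ K * Real.exp (-(Real.pi / 2) * rho ^ 2) := by
  set I := ∫ t in Set.Ioi (1 : ℝ),
    t ^ ((ν / 2 - 1).re) * Real.exp (-(Real.pi / 2 * δ ^ 2) * t)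
  refine ⟨max ‖-2 / ν‖ I, fun rho hrho => ?_⟩
  by_cases h0 : rho = 0
  · simp [crandallProfile, h0]
  have hpos : 0 < rho := hδ.trans_le (hrho.resolve_left h0)
  calc ‖crandallProfile ν rho‖ ≤ I * Real.exp (-(Real.pi / 2) * rho ^ 2) := by
        rw [crandallProfile_eq_integral ν hpos, ← MeasureTheory.integral_mul_const]
        refine MeasureTheory.norm_integral_le_of_norm_le
          ((integrableOn_rpow_mul_exp_neg _ (by positivity)).mul_const _)
          ((MeasureTheory.ae_restrict_iff' measurableSet_Ioi).2 (.of_forall fun t ht => ?_))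
        have ht0 : (0 : ℝ) < t := zero_lt_one.trans ht
        rw [norm_mul, Complex.norm_cpow_eq_rpow_re_of_pos ht0, Complex.norm_real,
          Real.norm_of_nonneg (puncturedGaussian_nonneg _ _), mul_assoc,
          mul_comm (Real.exp (-(Real.pi / 2 * δ ^ 2) * t))]
        gcongr
        exact puncturedGaussian_le hδ hrho (Set.mem_Ioi.1 ht).le
    _ ≤ _ := by gcongr; exact le_max_right _ _

namespace GaussianSummable

variable {ι : Type*} {a : ι → ℂ} {r : ι → ℝ}

/-- Termwise integration: the Crandall sum is the upper Mellin transform of the theta series plus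
the contribution of radius `0`. -/
theorem hasSum_crandallProfile [Countable ι] (h : GaussianSummable a r) (ν : ℂ) :
    HasSum (fun i => crandallProfile ν (r i) * a i)
      (upperMellin a r (ν / 2) + zeroCoeff a r * (-2 / ν)) := by
  obtain ⟨δ, hδ, hgap⟩ := h.gap
  have hmeas (i : ι) : MeasureTheory.AEStronglyMeasurable
      (fun t : ℝ => (t : ℂ) ^ (ν / 2 - 1) * (a i * (puncturedGaussian (r i) t : ℂ)))
      (MeasureTheory.volume.restrict (Set.Ioi 1)) := by
    refine ContinuousOn.aestronglyMeasurable (fun t ht => ?_) measurableSet_Ioi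
    have ht0 : t ≠ 0 := (zero_lt_one.trans ht).ne'
    exact ((Complex.continuousAt_ofReal_cpow_const _ _ (.inr ht0)).mul
      (continuous_const.mul (Complex.continuous_ofReal.comp
        (continuous_puncturedGaussian _))).continuousAt).continuousWithinAt
  have hbound (i : ι) : ∀ t ∈ Set.Ioi (1 : ℝ),
      ‖(t : ℂ) ^ (ν / 2 - 1) * (a i * (puncturedGaussian (r i) t : ℂ))‖ ≤
        ‖a i‖ * Real.exp (-(Real.pi / 2) * r i ^ 2) *
          (t ^ (ν / 2 - 1).re * Real.exp (-(Real.pi / 2 * δ ^ 2) * t)) := fun t ht => by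
    have ht0 : (0 : ℝ) < t := zero_lt_one.trans ht
    rw [norm_mul, Complex.norm_cpow_eq_rpow_re_of_pos ht0, norm_mul, Complex.norm_real,
      Real.norm_of_nonneg (puncturedGaussian_nonneg _ _)]
    have := mul_le_mul_of_nonneg_left (puncturedGaussian_le hδ (hgap i) (Set.mem_Ioi.1 ht).le)
      (mul_nonneg (Real.rpow_nonneg ht0.le (ν / 2 - 1).re) (norm_nonneg (a i)))
    linarith
  have hmaj := integrableOn_rpow_mul_exp_neg (ν / 2 - 1).re
    (show 0 < Real.pi / 2 * δ ^ 2 by positivity)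
  have hint (i : ι) : MeasureTheory.Integrable
      (fun t : ℝ => (t : ℂ) ^ (ν / 2 - 1) * (a i * (puncturedGaussian (r i) t : ℂ)))
      (MeasureTheory.volume.restrict (Set.Ioi 1)) :=
    (hmaj.const_mul _).mono' (hmeas i)
      ((MeasureTheory.ae_restrict_iff' measurableSet_Ioi).2 (.of_forall (hbound i)))
  have hsum : Summable fun i => ∫ t in Set.Ioi (1 : ℝ),
      ‖(t : ℂ) ^ (ν / 2 - 1) * (a i * (puncturedGaussian (r i) t : ℂ))‖ := by
    refine ((h.summable _ (half_pos Real.pi_pos)).mul_right (∫ t in Set.Ioi (1 : ℝ),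
      t ^ (ν / 2 - 1).re * Real.exp (-(Real.pi / 2 * δ ^ 2) * t))).of_nonneg_of_le
      (fun i => MeasureTheory.integral_nonneg fun _ => norm_nonneg _) fun i => ?_
    rw [← MeasureTheory.integral_const_mul]
    exact MeasureTheory.integral_mono_ae (hint i).norm (hmaj.const_mul _)
      ((MeasureTheory.ae_restrict_iff' measurableSet_Ioi).2 (.of_forall (hbound i)))
  have key := MeasureTheory.hasSum_integral_of_summable_integral_norm hint hsum
  have hT : ∫ t in Set.Ioi (1 : ℝ),
      ∑' i, (t : ℂ) ^ (ν / 2 - 1) * (a i * (puncturedGaussian (r i) t : ℂ)) =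
        upperMellin a r (ν / 2) := by
    have hind : Set.indicator (Set.Ioi (1 : ℝ)) (fun t : ℝ => ∑' i,
        (t : ℂ) ^ (ν / 2 - 1) * (a i * (puncturedGaussian (r i) t : ℂ))) =
        fun t : ℝ => (t : ℂ) ^ (ν / 2 - 1) •
          Set.indicator (Set.Ioi 1) (puncturedTheta a r) t := by
      funext t
      by_cases ht : t ∈ Set.Ioi (1 : ℝ)
      · simp only [Set.indicator_of_mem ht, tsum_mul_left, puncturedTheta, smul_eq_mul]
      · simp only [Set.indicator_of_notMem ht, smul_zero]
    rw [upperMellin, mellin, ← hind, MeasureTheory.setIntegral_indicator measurableSet_Ioi,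
      Set.inter_eq_right.2 (Set.Ioi_subset_Ioi zero_le_one)]
  rw [hT] at key
  refine (key.add (h.summable_zeroCoeff.hasSum.mul_right (-2 / ν))).congr_fun fun i => ?_
  by_cases h0 : r i = 0
  · simp [h0, puncturedGaussian, crandallProfile, mul_comm]
  · rw [if_neg h0, zero_mul, add_zero,
      crandallProfile_eq_integral ν ((h.nonneg i).lt_of_ne' h0), ← MeasureTheory.integral_mul_const]
    exact MeasureTheory.integral_congr_ae (.of_forall fun t => by ring)

/-- **Riemann's splitting** of the Mellin transform at `t = 1`: the part over `(0, 1)` is carried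
to `(1, ∞)` by a theta functional equation of weight `κ`. -/
theorem mellin_puncturedTheta {ι' : Type*} {a' : ι' → ℂ} {r' : ι' → ℝ}
    (h : GaussianSummable a r) (h' : GaussianSummable a' r') {c : ℂ} {κ : ℝ}
    (hfe : ∀ t : ℝ, 0 < t → puncturedTheta a r t + zeroCoeff a r =
      c * (t : ℂ) ^ (-κ : ℂ) * (puncturedTheta a' r' t⁻¹ + zeroCoeff a' r'))
    {s : ℂ} (hs : 0 < s.re) (hsκ : κ < s.re) :
    mellin (puncturedTheta a r) s = upperMellin a r s + zeroCoeff a r * (-1 / s) +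
      c * (upperMellin a' r' (κ - s) + zeroCoeff a' r' * (-1 / (κ - s))) := by
  set φ : ℝ → ℂ := Set.indicator (Set.Ioi 1) (puncturedTheta a' r')
  -- the four pieces of `θ` on `(0, ∞)`; the point `t = 1` is negligible
  have hdecomp : ∀ t ∈ Set.Ioi (0 : ℝ), t ≠ 1 → puncturedTheta a r t =
      Set.indicator (Set.Ioi 1) (puncturedTheta a r) t +
        c • ((t : ℂ) ^ (-κ : ℂ) • φ t⁻¹) +
        (c * zeroCoeff a' r') • Set.indicator (Set.Ioc 0 1) (fun t : ℝ => (t : ℂ) ^ (-κ : ℂ)) t -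
        zeroCoeff a r • Set.indicator (Set.Ioc 0 1) (fun _ => 1) t := by
    intro t ht ht1
    rcases lt_or_gt_of_ne ht1 with h1 | h1
    · have hinv : t⁻¹ ∈ Set.Ioi (1 : ℝ) := (one_lt_inv₀ ht).2 h1
      simp only [φ, Set.indicator_of_mem hinv, Set.indicator_of_mem (show t ∈ Set.Ioc (0 : ℝ) 1
        from ⟨ht, h1.le⟩), Set.indicator_of_notMem (show t ∉ Set.Ioi (1 : ℝ) from
        fun h => lt_asymm h1 h), smul_eq_mul]
      linear_combination hfe t ht
    · have hinv : t⁻¹ ∉ Set.Ioi (1 : ℝ) := by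
        simpa using (inv_lt_one_of_one_lt₀ h1).le
      simp only [φ, Set.indicator_of_notMem hinv, Set.indicator_of_mem (Set.mem_Ioi.2 h1),
        Set.indicator_of_notMem (show t ∉ Set.Ioc (0 : ℝ) 1 from fun h => h1.not_ge h.2),
        smul_zero, add_zero, sub_zero]
  have m1 := h.mellinConvergent_indicator s
  have m2 : HasMellin (fun t : ℝ => c • ((t : ℂ) ^ (-κ : ℂ) • φ t⁻¹)) s
      (c • upperMellin a' r' (κ - s)) := by
    have hconv : MellinConvergent (fun t : ℝ => (t : ℂ) ^ (-κ : ℂ) • φ t⁻¹) s := by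
      rw [MellinConvergent.cpow_smul]
      have := (MellinConvergent.comp_rpow (f := φ) (s := s + -κ) (a := -1) (by norm_num)).2
        (h'.mellinConvergent_indicator _)
      simpa only [Real.rpow_neg_one] using this
    refine ⟨hconv.const_smul c, ?_⟩
    rw [mellin_const_smul, mellin_cpow_smul, mellin_comp_inv, upperMellin]
    congr 2
    ring
  have m3 := hasMellin_const_smul (hasMellin_cpow_Ioc (-κ : ℂ) (s := s) (by simpa using hsκ)).1
    (c * zeroCoeff a' r')
  have m4 := hasMellin_const_smul (hasMellin_one_Ioc hs).1 (zeroCoeff a r)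
  have m12 := hasMellin_add m1 m2.1
  have m123 := hasMellin_add m12.1 m3.1
  have m := hasMellin_sub m123.1 m4.1
  have heq : mellin (puncturedTheta a r) s = mellin (fun t =>
      Set.indicator (Set.Ioi 1) (puncturedTheta a r) t + c • ((t : ℂ) ^ (-κ : ℂ) • φ t⁻¹) +
        (c * zeroCoeff a' r') • Set.indicator (Set.Ioc 0 1) (fun t : ℝ => (t : ℂ) ^ (-κ : ℂ)) t -
        zeroCoeff a r • Set.indicator (Set.Ioc 0 1) (fun _ => 1) t) s := by
    refine MeasureTheory.integral_congr_ae ?_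
    have hne : ∀ᵐ t : ℝ ∂(MeasureTheory.volume.restrict (Set.Ioi 0)), t ≠ 1 :=
      MeasureTheory.ae_restrict_of_ae (by simp [MeasureTheory.ae_iff])
    filter_upwards [hne, MeasureTheory.ae_restrict_mem measurableSet_Ioi] with t ht1 ht
    rw [hdecomp t ht ht1]
  rw [heq, m.2, m123.2, m12.2, m2.2, mellin_const_smul, mellin_const_smul,
    (hasMellin_cpow_Ioc (-κ : ℂ) (s := s) (by simpa using hsκ)).2, (hasMellin_one_Ioc hs).2,
    ← upperMellin]
  have hne : s - κ ≠ 0 := fun h0 => by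
    have := congrArg Complex.re h0
    simp at this
    linarith
  have : (-1 : ℂ) / (κ - s) = 1 / (s + -κ) := by
    rw [← sub_eq_add_neg, ← neg_sub s, neg_div_neg_eq]
  rw [this]
  simp only [smul_eq_mul]
  ring

end GaussianSummable

/-! ### Sums over lattices -/

/-- The lattice as a `ℤ`-span of a basis of `ℝ^d`. -/
theorem exists_basis_span_eq_latticeOf {d : ℕ} {A : Matrix (Fin d) (Fin d) ℝ} (hA : A.det ≠ 0) :
    ∃ b : Module.Basis (Fin d) ℝ (EuclideanSpace ℝ (Fin d)),
      latticeOf A = Submodule.span ℤ (Set.range b) := by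
  let e : (Fin d → ℝ) ≃ₗ[ℝ] EuclideanSpace ℝ (Fin d) :=
    (Matrix.toLinearEquiv' A (A.invertibleOfIsUnitDet hA.isUnit)).trans
      (WithLp.linearEquiv 2 ℝ (Fin d → ℝ)).symm
  have he (v : Fin d → ℝ) : e v = WithLp.toLp 2 (A.mulVec v) := rfl
  refine ⟨(Pi.basisFun ℝ (Fin d)).map e, ?_⟩
  ext z
  rw [SetLike.mem_coe, Submodule.mem_span_range_iff_exists_fun]
  refine exists_congr fun n => ?_
  have : ∑ i, n i • ((Pi.basisFun ℝ (Fin d)).map e) i = e fun i => (n i : ℝ) := by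
    simp only [Module.Basis.map_apply, Pi.basisFun_apply, ← map_zsmul, ← map_sum]
    congr 1
    ext j
    simp [Finset.sum_apply, Pi.single_apply]
  rw [this, he, eq_comm]

instance countable_latticeOf {d : ℕ} (A : Matrix (Fin d) (Fin d) ℝ) : Countable ↥(latticeOf A) := by
  refine Set.Countable.to_subtype ((Set.countable_range
    fun n : Fin d → ℤ => WithLp.toLp 2 (A.mulVec fun i => (n i : ℝ))).mono ?_)
  rintro z ⟨n, rfl⟩
  exact ⟨n, rfl⟩

section

variable {d : ℕ} {A : Matrix (Fin d) (Fin d) ℝ}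

theorem summable_latticeOf_rpow (hA : A.det ≠ 0) (x : EuclideanSpace ℝ (Fin d)) {σ : ℝ}
    (hσ : d < σ) : Summable fun z : ↥(latticeOf A) =>
      ‖(z : EuclideanSpace ℝ (Fin d)) - x‖ ^ (-σ) := by
  obtain ⟨b, hb⟩ := exists_basis_span_eq_latticeOf hA
  rw [hb]
  refine ZLattice.summable_norm_sub_rpow (Submodule.span ℤ (Set.range b)) (-σ) ?_ x
  rw [ZLattice.rank ℝ]
  simpa using hσ

theorem summable_latticeOf_gaussian (hA : A.det ≠ 0) (x : EuclideanSpace ℝ (Fin d)) {c : ℝ}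
    (hc : 0 < c) : Summable fun z : ↥(latticeOf A) =>
      Real.exp (-c * ‖(z : EuclideanSpace ℝ (Fin d)) - x‖ ^ 2) := by
  -- away from `z = x`, the Gaussian is `O(|z - x| ^ (-2 (d + 1)))`
  have h1 := (summable_latticeOf_rpow hA x (σ := (2 * (d + 1) : ℕ)) (by
    push_cast; linarith)).mul_left ((d + 1).factorial / c ^ (d + 1))
  have h2 : Summable fun z : ↥(latticeOf A) =>
      Set.indicator {z : ↥(latticeOf A) | (z : EuclideanSpace ℝ (Fin d)) = x}
        (fun _ => (1 : ℝ)) z :=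
    summable_of_hasFiniteSupport ((Set.Subsingleton.finite fun z hz w hw =>
      Subtype.ext (hz.trans hw.symm)).subset (Set.support_indicator_subset))
  refine (h1.add h2).of_nonneg_of_le (fun _ => (Real.exp_pos _).le) fun z => ?_
  by_cases hz : (z : EuclideanSpace ℝ (Fin d)) = x
  · rw [Set.indicator_of_mem (by exact hz), hz]
    simp only [sub_self, norm_zero]
    norm_num
    positivity
  · rw [Set.indicator_of_notMem (by exact hz), add_zero]
    have hpos : 0 < ‖(z : EuclideanSpace ℝ (Fin d)) - x‖ := norm_pos_iff.2 (sub_ne_zero.2 hz)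
    set u := ‖(z : EuclideanSpace ℝ (Fin d)) - x‖
    have h3 := Real.pow_div_factorial_le_exp (c * u ^ 2) (by positivity) (d + 1)
    rw [neg_mul, Real.exp_neg, Real.rpow_neg hpos.le, Real.rpow_natCast]
    rw [div_le_iff₀ (by positivity)] at h3
    rw [← div_eq_mul_inv, div_div, inv_eq_one_div, div_le_div_iff₀ (by positivity) (by positivity)]
    rw [mul_pow, ← pow_mul] at h3
    linarith

/-- Lattice points other than `x` keep a positive distance from `x`: by Gaussian summability only
finitely many of them lie in the unit ball around `x`. -/
theorem exists_latticeOf_gap (hA : A.det ≠ 0) (x : EuclideanSpace ℝ (Fin d)) :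
    ∃ δ : ℝ, 0 < δ ∧ ∀ z ∈ latticeOf A, z = x ∨ δ ≤ ‖z - x‖ := by
  have hfin : {z : ↥(latticeOf A) | ¬ Real.exp (-1 * ‖(z : EuclideanSpace ℝ (Fin d)) - x‖ ^ 2) <
      Real.exp (-1)}.Finite :=
    (summable_latticeOf_gaussian hA x one_pos).tendsto_cofinite_zero.eventually_lt_const
      (Real.exp_pos (-1))
  have hcl : IsClosed ((Subtype.val '' {z : ↥(latticeOf A) |
      ¬ Real.exp (-1 * ‖(z : EuclideanSpace ℝ (Fin d)) - x‖ ^ 2) < Real.exp (-1)}) \ {x}) :=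
    ((hfin.image _).subset Set.sdiff_subset).isClosed
  obtain ⟨ε, hε, hball⟩ := Metric.mem_nhds_iff.1 (hcl.isOpen_compl.mem_nhds (x := x) (by simp))
  refine ⟨min ε 1, by positivity, fun z hz => ?_⟩
  by_contra! hcon
  obtain ⟨hzx, hlt⟩ := hcon
  refine hball (mem_ball_iff_norm.2 (hlt.trans_le (min_le_left _ _))) ⟨⟨⟨z, hz⟩, ?_, rfl⟩, hzx⟩
  have h1 : ‖z - x‖ < 1 := hlt.trans_le (min_le_right _ _)
  have h2 : ‖z - x‖ ^ 2 ≤ 1 := pow_le_one₀ (norm_nonneg _) h1.le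
  simp only [Set.mem_ofPred_eq, not_lt, Real.exp_le_exp]
  linarith

/-- Lattice points scaled and shifted, with unimodular coefficients, form a Gaussian summable
family. -/
theorem gaussianSummable_latticeOf (hA : A.det ≠ 0) (x : EuclideanSpace ℝ (Fin d)) {μ : ℝ}
    (hμ : 0 < μ) {a : ↥(latticeOf A) → ℂ} (ha : ∀ z, ‖a z‖ = 1) :
    GaussianSummable a fun z => ‖μ • ((z : EuclideanSpace ℝ (Fin d)) - x)‖ where
  nonneg _ := norm_nonneg _
  summable c hc := by
    refine (summable_latticeOf_gaussian hA x (c := c * μ ^ 2) (by positivity)).congr fun z => ?_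
    rw [ha, one_mul, norm_smul, Real.norm_of_nonneg hμ.le, mul_pow, neg_mul, neg_mul, mul_assoc]
  gap := by
    obtain ⟨δ, hδ, h⟩ := exists_latticeOf_gap hA x
    refine ⟨μ * δ, by positivity, fun z => ?_⟩
    rcases h z z.2 with hz | hz
    · left; simp [hz]
    · right
      rw [norm_smul, Real.norm_of_nonneg hμ.le]
      gcongr

/-- A function on the lattice dominated by a shifted Gaussian is superexponentially summable. -/
theorem SuperexponentiallyConvergent.of_gaussian_bound (hA : A.det ≠ 0)
    (x : EuclideanSpace ℝ (Fin d)) {f : EuclideanSpace ℝ (Fin d) → ℂ} {K c : ℝ} (hc : 0 < c)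
    (hf : ∀ z ∈ latticeOf A, ‖f z‖ ≤ K * Real.exp (-c * ‖z - x‖ ^ 2)) :
    SuperexponentiallyConvergent (latticeOf A) f := by
  have hsum : Summable fun z : ↥(latticeOf A) => ‖f z‖ :=
    ((summable_latticeOf_gaussian hA x hc).mul_left K).of_nonneg_of_le
      (fun _ => norm_nonneg _) fun z => hf z z.2
  have hK : 0 ≤ K := by
    have h0 : (0 : EuclideanSpace ℝ (Fin d)) ∈ latticeOf A :=
      ⟨0, by simp only [Pi.zero_apply, Int.cast_zero, ← Pi.zero_def, Matrix.mulVec_zero]; rfl⟩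
    exact nonneg_of_mul_nonneg_left ((norm_nonneg _).trans (hf 0 h0)) (Real.exp_pos _)
  have hg := summable_latticeOf_gaussian hA 0 (c := c / 4) (by positivity)
  refine ⟨hsum, K * Real.exp (c * ‖x‖ ^ 2) * ∑' z : ↥(latticeOf A),
    Real.exp (-(c / 4) * ‖(z : EuclideanSpace ℝ (Fin d)) - 0‖ ^ 2), c / 4, by positivity,
    fun ρ hρ => ?_⟩
  let emb : ↥(latticeOf A ∩ {z | ρ < ‖z‖}) → ↥(latticeOf A) := Set.inclusion Set.inter_subset_left
  have hemb : Function.Injective emb := Set.inclusion_injective _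
  have hle (z : ↥(latticeOf A ∩ {z | ρ < ‖z‖})) : ‖f z‖ ≤ K * Real.exp (c * ‖x‖ ^ 2) *
      Real.exp (-(c / 4) * ρ ^ 2) *
        Real.exp (-(c / 4) * ‖(emb z : EuclideanSpace ℝ (Fin d)) - 0‖ ^ 2) := by
    refine (hf z z.2.1).trans ?_
    rw [mul_assoc, mul_assoc, ← Real.exp_add, ← Real.exp_add]
    refine mul_le_mul_of_nonneg_left (Real.exp_le_exp.2 ?_) hK
    have h1 : ρ ^ 2 ≤ ‖(z : EuclideanSpace ℝ (Fin d))‖ ^ 2 := pow_le_pow_left₀ hρ z.2.2.le 2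
    -- `|z|² ≤ 2 |z - x|² + 2 |x|²`
    have h2 : ‖(z : EuclideanSpace ℝ (Fin d))‖ ≤ ‖(z : EuclideanSpace ℝ (Fin d)) - x‖ + ‖x‖ := by
      simpa using norm_add_le ((z : EuclideanSpace ℝ (Fin d)) - x) x
    have h3 := pow_le_pow_left₀ (norm_nonneg _) h2 2
    have h4 := sq_nonneg (‖(z : EuclideanSpace ℝ (Fin d)) - x‖ - ‖x‖)
    have h5 : ‖(z : EuclideanSpace ℝ (Fin d))‖ ^ 2 ≤
        2 * ‖(z : EuclideanSpace ℝ (Fin d)) - x‖ ^ 2 + 2 * ‖x‖ ^ 2 := by linarith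
    have h6 : (emb z : EuclideanSpace ℝ (Fin d)) = z := rfl
    rw [h6, sub_zero]
    nlinarith
  calc ∑' z : ↥(latticeOf A ∩ {z | ρ < ‖z‖}), ‖f z‖
      ≤ ∑' z : ↥(latticeOf A ∩ {z | ρ < ‖z‖}), K * Real.exp (c * ‖x‖ ^ 2) *
          Real.exp (-(c / 4) * ρ ^ 2) *
            Real.exp (-(c / 4) * ‖(emb z : EuclideanSpace ℝ (Fin d)) - 0‖ ^ 2) :=
        (hsum.comp_injective hemb).tsum_le_tsum hle ((hg.comp_injective hemb).mul_left _)
    _ = K * Real.exp (c * ‖x‖ ^ 2) * Real.exp (-(c / 4) * ρ ^ 2) *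
          ∑' z, Real.exp (-(c / 4) * ‖(emb z : EuclideanSpace ℝ (Fin d)) - 0‖ ^ 2) := tsum_mul_left
    _ ≤ K * Real.exp (c * ‖x‖ ^ 2) * Real.exp (-(c / 4) * ρ ^ 2) *
          ∑' z : ↥(latticeOf A),
            Real.exp (-(c / 4) * ‖(z : EuclideanSpace ℝ (Fin d)) - 0‖ ^ 2) := by
        gcongr
        exact tsum_comp_le_tsum_of_inj hg (fun _ => (Real.exp_pos _).le) hemb
    _ = _ := by ring

/-- The parametrization `n ↦ A n` of the lattice by `ℤ^d`. -/
noncomputable def latticeEquiv (hA : A.det ≠ 0) : (Fin d → ℤ) ≃ ↥(latticeOf A) :=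
  Equiv.ofBijective
    (fun n => ⟨WithLp.toLp 2 (A.mulVec fun i => (n i : ℝ)), n, rfl⟩)
    ⟨fun n m hnm => by
      have h := WithLp.toLp_injective 2 (congrArg Subtype.val hnm)
      have h2 := Matrix.mulVec_injective_of_isUnit ((Matrix.isUnit_iff_isUnit_det A).2 hA.isUnit) h
      exact funext fun i => by exact_mod_cast congrFun h2 i,
    fun z => by
      obtain ⟨n, hn⟩ := z.2
      exact ⟨n, Subtype.ext hn.symm⟩⟩

@[simp]
theorem coe_latticeEquiv (hA : A.det ≠ 0) (n : Fin d → ℤ) :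
    (latticeEquiv hA n : EuclideanSpace ℝ (Fin d)) =
      WithLp.toLp 2 (A.mulVec fun i => (n i : ℝ)) := rfl

end

/-! ### The theta functional equation -/

/-- Fourier transform of a translated Gaussian. -/
theorem integral_character_mul_gaussian {d : ℕ} (x q : EuclideanSpace ℝ (Fin d)) {t : ℝ}
    (ht : 0 < t) :
    ∫ w : EuclideanSpace ℝ (Fin d), Complex.exp (-2 * Real.pi * Complex.I * (inner ℝ q w : ℝ)) *
      (Real.exp (-Real.pi * t * ‖w - x‖ ^ 2) : ℂ) =
    (t : ℂ) ^ (-((d / 2 : ℝ) : ℂ)) * (Complex.exp (-2 * Real.pi * Complex.I * (inner ℝ x q : ℝ)) *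
      (Real.exp (-Real.pi * t⁻¹ * ‖q‖ ^ 2) : ℂ)) := by
  have htc : (t : ℂ) ≠ 0 := Complex.ofReal_ne_zero.2 ht.ne'
  have hpi : (Real.pi : ℂ) ≠ 0 := Complex.ofReal_ne_zero.2 Real.pi_ne_zero
  have hb : 0 < ((Real.pi * t : ℝ) : ℂ).re := by rw [Complex.ofReal_re]; positivity
  have key := GaussianFourier.integral_cexp_neg_mul_sq_norm_add_of_euclideanSpace hb
    (-2 * Real.pi * Complex.I) q
  rw [← MeasureTheory.integral_add_right_eq_self _ x]
  have h1 (w : EuclideanSpace ℝ (Fin d)) :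
      Complex.exp (-2 * Real.pi * Complex.I * (inner ℝ q (w + x) : ℝ)) *
        (Real.exp (-Real.pi * t * ‖w + x - x‖ ^ 2) : ℂ) =
      Complex.exp (-2 * Real.pi * Complex.I * (inner ℝ x q : ℝ)) *
        Complex.exp (-((Real.pi * t : ℝ) : ℂ) * (‖w‖ : ℂ) ^ 2 +
          -2 * Real.pi * Complex.I * (inner ℝ q w : ℝ)) := by
    rw [Complex.ofReal_exp, ← Complex.exp_add, ← Complex.exp_add, inner_add_right,
      real_inner_comm x q, add_sub_cancel_right]
    congr 1
    push_cast
    ring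
  simp only [h1]
  rw [MeasureTheory.integral_const_mul, key, Fintype.card_fin]
  have h2 : ((Real.pi : ℂ) / ((Real.pi * t : ℝ) : ℂ)) ^ ((d : ℂ) / 2) =
      (t : ℂ) ^ (-((d / 2 : ℝ) : ℂ)) := by
    have : (Real.pi : ℂ) / ((Real.pi * t : ℝ) : ℂ) = (t : ℂ)⁻¹ := by
      push_cast; field_simp
    rw [this, Complex.inv_cpow _ _ (by
      rw [Complex.arg_ofReal_of_nonneg ht.le]; exact Real.pi_ne_zero.symm), ← Complex.cpow_neg]
    push_cast
    rfl
  have h3 : (-2 * Real.pi * Complex.I) ^ 2 * (‖q‖ : ℂ) ^ 2 / (4 * ((Real.pi * t : ℝ) : ℂ)) =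
      ((-Real.pi * t⁻¹ * ‖q‖ ^ 2 : ℝ) : ℂ) := by
    push_cast
    field_simp
    rw [Complex.I_sq]
    ring
  rw [h2, h3, Complex.ofReal_exp]
  ring

/-- The linear change of variables `w = A v`. -/
theorem integral_comp_mulVec {d : ℕ} {A : Matrix (Fin d) (Fin d) ℝ} (hA : A.det ≠ 0)
    {g : EuclideanSpace ℝ (Fin d) → ℂ} (hg : Continuous g) :
    ∫ v : Fin d → ℝ, g (WithLp.toLp 2 (A.mulVec v)) = ((|A.det|⁻¹ : ℝ) : ℂ) * ∫ w, g w := by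
  have h1 : ∫ v : Fin d → ℝ, g (WithLp.toLp 2 (A.mulVec v)) =
      ∫ u, g (WithLp.toLp 2 u) ∂(MeasureTheory.Measure.map (Matrix.toLin' A)
        MeasureTheory.volume) := by
    rw [MeasureTheory.integral_map]
    · rfl
    · exact (LinearMap.continuous_of_finiteDimensional _).aemeasurable
    · exact (hg.comp (PiLp.continuous_toLp 2 _)).aestronglyMeasurable
  rw [h1, Real.map_matrix_volume_pi_eq_smul_volume_pi hA, MeasureTheory.integral_smul_measure,
    ENNReal.toReal_ofReal (abs_nonneg _), abs_inv, Complex.real_smul,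
    (PiLp.volume_preserving_toLp (Fin d)).integral_comp
      (MeasurableEquiv.toLp 2 _).measurableEmbedding]

/-- The reciprocal lattice is dual to the lattice: `A^{-T} n · A v = n · v`. -/
theorem inner_reciprocal {d : ℕ} {A : Matrix (Fin d) (Fin d) ℝ} (hA : A.det ≠ 0)
    (n v : Fin d → ℝ) :
    (inner ℝ (WithLp.toLp 2 ((A⁻¹).transpose.mulVec n) : EuclideanSpace ℝ (Fin d))
      (WithLp.toLp 2 (A.mulVec v)) : ℝ) = ∑ i, n i * v i := by
  rw [EuclideanSpace.inner_toLp_toLp, star_trivial, Matrix.mulVec_transpose, dotProduct_comm,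
    ← Matrix.dotProduct_mulVec, Matrix.mulVec_mulVec, Matrix.nonsing_inv_mul _ hA.isUnit,
    Matrix.one_mulVec]
  rfl

theorem det_reciprocal_ne_zero {d : ℕ} {A : Matrix (Fin d) (Fin d) ℝ} (hA : A.det ≠ 0) :
    (A⁻¹).transpose.det ≠ 0 := by
  rw [Matrix.det_transpose, Matrix.det_nonsing_inv, Ring.inverse_eq_inv']
  exact inv_ne_zero hA

theorem norm_exp_neg_two_pi_I_mul (u : ℝ) :
    ‖Complex.exp (-2 * Real.pi * Complex.I * u)‖ = 1 := by
  rw [Complex.norm_exp]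
  simp

/-- The functional equation of the theta series of a lattice, with a translation and a character. -/
theorem theta_functional_equation {d : ℕ} {A : Matrix (Fin d) (Fin d) ℝ} (hA : A.det ≠ 0)
    (x y : EuclideanSpace ℝ (Fin d)) {t : ℝ} (ht : 0 < t) :
    ∑' z : ↥(latticeOf A), Complex.exp (-2 * Real.pi * Complex.I *
        (inner ℝ y (z : EuclideanSpace ℝ (Fin d)) : ℝ)) *
        (Real.exp (-Real.pi * t * ‖(z : EuclideanSpace ℝ (Fin d)) - x‖ ^ 2) : ℂ) =
      ((|A.det|⁻¹ : ℝ) : ℂ) * (t : ℂ) ^ (-((d / 2 : ℝ) : ℂ)) *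
      ∑' k : ↥(reciprocalLatticeOf A), Complex.exp (-2 * Real.pi * Complex.I *
        (inner ℝ x ((k : EuclideanSpace ℝ (Fin d)) + y) : ℝ)) *
        (Real.exp (-Real.pi * t⁻¹ * ‖(k : EuclideanSpace ℝ (Fin d)) + y‖ ^ 2) : ℂ) := by
  have hA' := det_reciprocal_ne_zero hA
  set g : EuclideanSpace ℝ (Fin d) → ℂ := fun w =>
    Complex.exp (-2 * Real.pi * Complex.I * (inner ℝ y w : ℝ)) *
      (Real.exp (-Real.pi * t * ‖w - x‖ ^ 2) : ℂ) with hg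
  have hgc : Continuous g := by fun_prop
  set k : (Fin d → ℤ) → EuclideanSpace ℝ (Fin d) := fun n =>
    WithLp.toLp 2 ((A⁻¹).transpose.mulVec fun i => (n i : ℝ)) with hk
  have hlin (v w : Fin d → ℝ) : (WithLp.toLp 2 (A.mulVec (v + w)) : EuclideanSpace ℝ (Fin d)) =
      WithLp.toLp 2 (A.mulVec v) + WithLp.toLp 2 (A.mulVec w) := by
    rw [Matrix.mulVec_add]; rfl
  have hAc : Continuous fun v : Fin d → ℝ =>
      (WithLp.toLp 2 (A.mulVec v) : EuclideanSpace ℝ (Fin d)) :=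
    (PiLp.continuous_toLp 2 _).comp
      (LinearMap.continuous_of_finiteDimensional (Matrix.toLin' A))
  have hcoeff (n : Fin d → ℤ) :
      ∫ v : Fin d → ℝ, Complex.exp (-2 * Real.pi * Complex.I * (∑ i, n i * v i : ℝ)) *
        g (WithLp.toLp 2 (A.mulVec v)) = ((|A.det|⁻¹ : ℝ) : ℂ) *
        ((t : ℂ) ^ (-((d / 2 : ℝ) : ℂ)) *
          (Complex.exp (-2 * Real.pi * Complex.I * (inner ℝ x (k n + y) : ℝ)) *
          (Real.exp (-Real.pi * t⁻¹ * ‖k n + y‖ ^ 2) : ℂ))) := by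
    rw [← integral_character_mul_gaussian x (k n + y) ht, ← integral_comp_mulVec hA (by fun_prop)]
    refine MeasureTheory.integral_congr_ae (.of_forall fun v => ?_)
    simp only [hg]
    rw [← mul_assoc, ← Complex.exp_add, inner_add_left, ← inner_reciprocal hA]
    congr 2
    push_cast
    ring
  have hsum : Summable fun n : Fin d → ℤ =>
      Complex.exp (-2 * Real.pi * Complex.I * (inner ℝ x (k n + y) : ℝ)) *
        (Real.exp (-Real.pi * t⁻¹ * ‖k n + y‖ ^ 2) : ℂ) := by
    refine .of_norm (((latticeEquiv hA').summable_iff.2 (summable_latticeOf_gaussian hA' (-y)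
      (c := Real.pi * t⁻¹) (by positivity))).congr fun n => ?_)
    rw [norm_mul, norm_exp_neg_two_pi_I_mul, one_mul, Complex.norm_real,
      Real.norm_of_nonneg (Real.exp_pos _).le, Function.comp_apply, coe_latticeEquiv,
      sub_neg_eq_add, neg_mul, neg_mul, neg_mul]
  have hbound (R : ℝ) : ∃ u : (Fin d → ℤ) → ℝ, Summable u ∧ ∀ v : Fin d → ℝ, ‖v‖ ≤ R →
      ∀ m : Fin d → ℤ, ‖g (WithLp.toLp 2 (A.mulVec (v + fun i => (m i : ℝ))))‖ ≤ u m := by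
    obtain ⟨M, hM⟩ := (isCompact_closedBall (0 : Fin d → ℝ) R).exists_bound_of_continuousOn
      (f := fun v => (WithLp.toLp 2 (A.mulVec v) : EuclideanSpace ℝ (Fin d)) - x)
      (hAc.sub continuous_const).continuousOn
    refine ⟨fun m => Real.exp (Real.pi * t * M ^ 2) * Real.exp (-(Real.pi * t / 2) *
      ‖(latticeEquiv hA m : EuclideanSpace ℝ (Fin d)) - 0‖ ^ 2),
      ((latticeEquiv hA).summable_iff.2 (summable_latticeOf_gaussian hA 0
        (c := Real.pi * t / 2) (by positivity))).mul_left _, fun v hv m => ?_⟩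
    have h1 := hM v (by simpa using hv)
    simp only [hg]
    rw [norm_mul, norm_exp_neg_two_pi_I_mul, one_mul, Complex.norm_real,
      Real.norm_of_nonneg (Real.exp_pos _).le, ← Real.exp_add, Real.exp_le_exp, hlin, sub_zero,
      coe_latticeEquiv]
    set p : EuclideanSpace ℝ (Fin d) := WithLp.toLp 2 (A.mulVec v)
    set q : EuclideanSpace ℝ (Fin d) := WithLp.toLp 2 (A.mulVec fun i => (m i : ℝ))
    -- `|q|² ≤ 2 |p + q - x|² + 2 |p - x|²`
    have h2 : ‖q‖ ≤ ‖p + q - x‖ + ‖p - x‖ := by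
      have := norm_sub_le (p + q - x) (p - x)
      rwa [show p + q - x - (p - x) = q by abel] at this
    have h3 : ‖q‖ ≤ ‖p + q - x‖ + M := h2.trans (by linarith)
    have h4 := pow_le_pow_left₀ (norm_nonneg _) h3 2
    have h5 := sq_nonneg (‖p + q - x‖ - M)
    have h6 : ‖q‖ ^ 2 ≤ 2 * ‖p + q - x‖ ^ 2 + 2 * M ^ 2 := by linarith
    have h7 := mul_le_mul_of_nonneg_left h6 (show 0 ≤ Real.pi * t / 2 by positivity)
    linarith
  have hP := tsum_int_eq_tsum_fourier (f := fun v => g (WithLp.toLp 2 (A.mulVec v)))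
    (hgc.comp hAc) hbound (by
      simp only [hcoeff]
      exact (hsum.mul_left _).mul_left _)
  simp only [hcoeff, tsum_mul_left] at hP
  rw [← (latticeEquiv hA).tsum_eq, mul_assoc (((|A.det|⁻¹ : ℝ) : ℂ))]
  refine hP.trans ?_
  congr 2
  exact (latticeEquiv hA').tsum_eq fun k : ↥(reciprocalLatticeOf A) =>
    Complex.exp (-2 * Real.pi * Complex.I *
      (inner ℝ x ((k : EuclideanSpace ℝ (Fin d)) + y) : ℝ)) *
      (Real.exp (-Real.pi * t⁻¹ * ‖(k : EuclideanSpace ℝ (Fin d)) + y‖ ^ 2) : ℂ)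

/-! ### The meromorphic continuation and Crandall's representation -/

/-- A global form of the identity theorem: meromorphic functions in normal form that agree near
one point are equal. -/
theorem MeromorphicNFOn.eq_of_eventuallyEq {f g : ℂ → ℂ} (hf : MeromorphicNFOn f Set.univ)
    (hg : MeromorphicNFOn g Set.univ) {z₀ : ℂ} (h : f =ᶠ[𝓝 z₀] g) : f = g := by
  have hmer : MeromorphicOn (f - g) Set.univ := hf.meromorphicOn.sub hg.meromorphicOn
  have htop : meromorphicOrderAt (f - g) z₀ = ⊤ := by
    refine meromorphicOrderAt_eq_top_iff.2 ((h.filter_mono nhdsWithin_le_nhds).mono fun w hw => ?_)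
    simp [hw]
  funext z
  have hz : meromorphicOrderAt (f - g) z = ⊤ := by
    by_contra hne
    exact hmer.meromorphicOrderAt_ne_top_of_isPreconnected isPreconnected_univ
      (Set.mem_univ z) (Set.mem_univ z₀) hne htop
  have hev : f =ᶠ[𝓝[≠] z] g :=
    (meromorphicOrderAt_eq_top_iff.1 hz).mono fun w hw => sub_eq_zero.1 hw
  exact (((hf (Set.mem_univ z)).eventuallyEq_nhdsNE_iff_eventuallyEq_nhds
    (hg (Set.mem_univ z))).1 hev).eq_of_nhds

section

variable {d : ℕ} {A : Matrix (Fin d) (Fin d) ℝ}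

/-- The coefficients `e^{-2πi y·z}` of the sum over `Λ`. -/
noncomputable def directCoeff (A : Matrix (Fin d) (Fin d) ℝ) (y : EuclideanSpace ℝ (Fin d))
    (z : ↥(latticeOf A)) : ℂ :=
  Complex.exp (-2 * Real.pi * Complex.I * (inner ℝ y (z : EuclideanSpace ℝ (Fin d)) : ℝ))

/-- The radii `|z - x| / lam` of the sum over `Λ`. -/
noncomputable def directRadius (A : Matrix (Fin d) (Fin d) ℝ) (x : EuclideanSpace ℝ (Fin d))
    (lam : ℝ) (z : ↥(latticeOf A)) : ℝ :=
  ‖lam⁻¹ • ((z : EuclideanSpace ℝ (Fin d)) - x)‖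

/-- The coefficients `e^{-2πi x·(k + y)}` of the sum over `Λ*`. -/
noncomputable def dualCoeff (A : Matrix (Fin d) (Fin d) ℝ) (x y : EuclideanSpace ℝ (Fin d))
    (k : ↥(reciprocalLatticeOf A)) : ℂ :=
  Complex.exp (-2 * Real.pi * Complex.I * (inner ℝ x ((k : EuclideanSpace ℝ (Fin d)) + y) : ℝ))

/-- The radii `lam |k + y|` of the sum over `Λ*`. -/
noncomputable def dualRadius (A : Matrix (Fin d) (Fin d) ℝ) (y : EuclideanSpace ℝ (Fin d))
    (lam : ℝ) (k : ↥(reciprocalLatticeOf A)) : ℝ :=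
  ‖lam • ((k : EuclideanSpace ℝ (Fin d)) + y)‖

instance countable_reciprocalLatticeOf (A : Matrix (Fin d) (Fin d) ℝ) :
    Countable ↥(reciprocalLatticeOf A) :=
  countable_latticeOf _

theorem gaussianSummable_direct (hA : A.det ≠ 0) (x y : EuclideanSpace ℝ (Fin d)) {lam : ℝ}
    (hlam : 0 < lam) : GaussianSummable (directCoeff A y) (directRadius A x lam) :=
  gaussianSummable_latticeOf hA x (inv_pos.2 hlam) fun _ => norm_exp_neg_two_pi_I_mul _

theorem gaussianSummable_dual (hA : A.det ≠ 0) (x y : EuclideanSpace ℝ (Fin d)) {lam : ℝ}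
    (hlam : 0 < lam) : GaussianSummable (dualCoeff A x y) (dualRadius A y lam) := by
  have := gaussianSummable_latticeOf (det_reciprocal_ne_zero hA) (-y) hlam
    (a := dualCoeff A x y) fun _ => norm_exp_neg_two_pi_I_mul _
  simpa only [sub_neg_eq_add] using! this

theorem zeroCoeff_direct_eq_zero {x y : EuclideanSpace ℝ (Fin d)} {lam : ℝ} (hlam : 0 < lam)
    (hx : x ∉ latticeOf A) : zeroCoeff (directCoeff A y) (directRadius A x lam) = 0 := by
  refine (tsum_congr fun z => if_neg fun h => hx ?_).trans tsum_zero
  rw [directRadius, norm_eq_zero, smul_eq_zero_iff_right (inv_ne_zero hlam.ne'), sub_eq_zero] at h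
  exact h ▸ z.2

theorem zeroCoeff_dual_eq_zero {x y : EuclideanSpace ℝ (Fin d)} {lam : ℝ} (hlam : 0 < lam)
    (hy : y ∉ reciprocalLatticeOf A) : zeroCoeff (dualCoeff A x y) (dualRadius A y lam) = 0 := by
  refine (tsum_congr fun k => if_neg fun h => hy ?_).trans tsum_zero
  rw [dualRadius, norm_eq_zero, smul_eq_zero_iff_right hlam.ne', add_eq_zero_iff_neg_eq] at h
  obtain ⟨n, hn⟩ := k.2
  refine ⟨-n, ?_⟩
  rw [← h, hn]
  have : (fun i => ((-n) i : ℝ)) = -fun i => (n i : ℝ) := by funext i; simp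
  rw [this, Matrix.mulVec_neg]
  rfl

/-- The functional equation between the theta series of `Λ` and `Λ*`, scaled by `lam`. -/
theorem scaled_theta_functional_equation (hA : A.det ≠ 0) (x y : EuclideanSpace ℝ (Fin d))
    {lam : ℝ} (hlam : 0 < lam) {t : ℝ} (ht : 0 < t) :
    puncturedTheta (directCoeff A y) (directRadius A x lam) t +
        zeroCoeff (directCoeff A y) (directRadius A x lam) =
      ((lam ^ d / cellVolume A : ℝ) : ℂ) * (t : ℂ) ^ (-((d / 2 : ℝ) : ℂ)) *
        (puncturedTheta (dualCoeff A x y) (dualRadius A y lam) t⁻¹ +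
          zeroCoeff (dualCoeff A x y) (dualRadius A y lam)) := by
  rw [← (gaussianSummable_direct hA x y hlam).tsum_gaussian ht,
    ← (gaussianSummable_dual hA x y hlam).tsum_gaussian (inv_pos.2 ht)]
  have key := theta_functional_equation hA x y (t := lam⁻¹ ^ 2 * t) (by positivity)
  have h1 (z : ↥(latticeOf A)) : -Real.pi * (lam⁻¹ ^ 2 * t) *
      ‖(z : EuclideanSpace ℝ (Fin d)) - x‖ ^ 2 = -Real.pi * directRadius A x lam z ^ 2 * t := by
    rw [directRadius, norm_smul, Real.norm_of_nonneg (inv_pos.2 hlam).le]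
    ring
  have h2 (k : ↥(reciprocalLatticeOf A)) : -Real.pi * (lam⁻¹ ^ 2 * t)⁻¹ *
      ‖(k : EuclideanSpace ℝ (Fin d)) + y‖ ^ 2 = -Real.pi * dualRadius A y lam k ^ 2 * t⁻¹ := by
    rw [dualRadius, norm_smul, Real.norm_of_nonneg hlam.le, mul_inv, inv_pow, inv_inv]
    ring
  have h3 : ((lam⁻¹ ^ 2 * t : ℝ) : ℂ) ^ (-((d / 2 : ℝ) : ℂ)) =
      ((lam ^ d : ℝ) : ℂ) * (t : ℂ) ^ (-((d / 2 : ℝ) : ℂ)) := by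
    rw [Complex.ofReal_mul, Complex.mul_cpow_ofReal_nonneg (by positivity) ht.le]
    congr 1
    rw [← Complex.ofReal_neg, ← Complex.ofReal_cpow (by positivity), inv_pow,
      Real.inv_rpow (by positivity), ← Real.rpow_neg (by positivity), neg_neg,
      ← Real.rpow_natCast, ← Real.rpow_mul hlam.le, ← Real.rpow_natCast]
    congr 2
    push_cast
    ring
  simp only [h1, h2, h3] at key
  refine key.trans ?_
  rw [cellVolume, ← mul_assoc, ← Complex.ofReal_mul, inv_mul_eq_div]
  rfl

theorem hasSum_crandallTerm (hA : A.det ≠ 0) (x y : EuclideanSpace ℝ (Fin d)) {lam : ℝ}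
    (hlam : 0 < lam) (ν : ℂ) :
    HasSum (fun z : ↥(latticeOf A) => crandallTerm x y lam ν z)
      (upperMellin (directCoeff A y) (directRadius A x lam) (ν / 2) +
        zeroCoeff (directCoeff A y) (directRadius A x lam) * (-2 / ν)) := by
  refine ((gaussianSummable_direct hA x y hlam).hasSum_crandallProfile ν).congr_fun fun z => ?_
  rw [crandallTerm, upperCrandall_eq_crandallProfile]
  rfl

theorem hasSum_crandallDualTerm (hA : A.det ≠ 0) (x y : EuclideanSpace ℝ (Fin d)) {lam : ℝ}
    (hlam : 0 < lam) (ν : ℂ) :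
    HasSum (fun k : ↥(reciprocalLatticeOf A) => crandallDualTerm x y lam ν k)
      (upperMellin (dualCoeff A x y) (dualRadius A y lam) ((d - ν) / 2) +
        zeroCoeff (dualCoeff A x y) (dualRadius A y lam) * (-2 / (d - ν))) := by
  refine ((gaussianSummable_dual hA x y hlam).hasSum_crandallProfile (d - ν)).congr_fun
    fun z => ?_
  rw [crandallDualTerm, upperCrandall_eq_crandallProfile]
  rfl

theorem superexponentiallyConvergent_crandallTerm (hA : A.det ≠ 0)
    (x y : EuclideanSpace ℝ (Fin d)) {lam : ℝ} (hlam : 0 < lam) (ν : ℂ) :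
    SuperexponentiallyConvergent (latticeOf A) (crandallTerm x y lam ν) := by
  obtain ⟨δ, hδ, hgap⟩ := (gaussianSummable_direct hA x y hlam).gap
  obtain ⟨K, hK⟩ := exists_norm_crandallProfile_le ν hδ
  refine .of_gaussian_bound hA x (K := K) (c := Real.pi / 2 * lam⁻¹ ^ 2) (by positivity)
    fun z hz => ?_
  rw [crandallTerm, norm_mul, norm_exp_neg_two_pi_I_mul, mul_one, upperCrandall_eq_crandallProfile]
  refine (hK _ (hgap ⟨z, hz⟩)).trans_eq ?_
  rw [directRadius, norm_smul, Real.norm_of_nonneg (inv_pos.2 hlam).le]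
  congr 2
  ring

theorem superexponentiallyConvergent_crandallDualTerm (hA : A.det ≠ 0)
    (x y : EuclideanSpace ℝ (Fin d)) {lam : ℝ} (hlam : 0 < lam) (ν : ℂ) :
    SuperexponentiallyConvergent (reciprocalLatticeOf A) (crandallDualTerm x y lam ν) := by
  obtain ⟨δ, hδ, hgap⟩ := (gaussianSummable_dual hA x y hlam).gap
  obtain ⟨K, hK⟩ := exists_norm_crandallProfile_le (d - ν) hδ
  refine .of_gaussian_bound (det_reciprocal_ne_zero hA) (-y) (K := K)
    (c := Real.pi / 2 * lam ^ 2) (by positivity) fun z (hz : z ∈ reciprocalLatticeOf A) => ?_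
  rw [crandallDualTerm, norm_mul, norm_exp_neg_two_pi_I_mul, mul_one,
    upperCrandall_eq_crandallProfile]
  refine (hK _ (hgap ⟨z, hz⟩)).trans_eq ?_
  rw [dualRadius, norm_smul, Real.norm_of_nonneg hlam.le, sub_neg_eq_add]
  congr 2
  ring

/-- Crandall's representation with the term `z = x`, namely `-2 / (ν Γ(ν/2))`, replaced by the
entire function `-1 / Γ(ν/2 + 1)`, and with both lattice sums in integral form. -/
noncomputable def regularizedCrandall (A : Matrix (Fin d) (Fin d) ℝ)
    (x y : EuclideanSpace ℝ (Fin d)) (lam : ℝ) (ν : ℂ) : ℂ :=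
  ((lam ^ 2 / Real.pi : ℝ) : ℂ) ^ (-ν / 2) *
    ((Complex.Gamma (ν / 2))⁻¹ *
      (upperMellin (directCoeff A y) (directRadius A x lam) (ν / 2) +
        ((lam ^ d / cellVolume A : ℝ) : ℂ) *
          (upperMellin (dualCoeff A x y) (dualRadius A y lam) ((d - ν) / 2) +
            zeroCoeff (dualCoeff A x y) (dualRadius A y lam) * (-2 / (d - ν)))) -
      zeroCoeff (directCoeff A y) (directRadius A x lam) * (Complex.Gamma (ν / 2 + 1))⁻¹)

/-- The two representations agree except at `ν = 0` with `x ∈ Λ`, where the term `-2 / ν` has the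
junk value `0`. -/
theorem crandallRepresentation_eq_regularizedCrandall (hA : A.det ≠ 0)
    (x y : EuclideanSpace ℝ (Fin d)) {lam : ℝ} (hlam : 0 < lam) {ν : ℂ}
    (h : ¬(ν = 0 ∧ x ∈ latticeOf A)) :
    crandallRepresentation A x y lam ν = regularizedCrandall A x y lam ν := by
  rw [crandallRepresentation, regularizedCrandall, (hasSum_crandallTerm hA x y hlam ν).tsum_eq,
    (hasSum_crandallDualTerm hA x y hlam ν).tsum_eq, div_eq_mul_inv]
  by_cases hν : ν = 0
  · rw [zeroCoeff_direct_eq_zero hlam fun hx => h ⟨hν, hx⟩]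
    ring
  · rw [Complex.Gamma_add_one _ (div_ne_zero hν two_ne_zero), mul_inv, inv_div]
    ring

/-- The regularized representation is entire up to an explicit term with a simple pole at `ν = d`.
-/
theorem exists_differentiable_regularizedCrandall (hA : A.det ≠ 0)
    (x y : EuclideanSpace ℝ (Fin d)) {lam : ℝ} (hlam : 0 < lam) :
    ∃ D₁ D₂ : ℂ → ℂ, Differentiable ℂ D₁ ∧ Differentiable ℂ D₂ ∧
      regularizedCrandall A x y lam = fun ν => D₁ ν +
        D₂ ν * (zeroCoeff (dualCoeff A x y) (dualRadius A y lam) * (-2 / (d - ν))) := by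
  have hT := (gaussianSummable_direct hA x y hlam).differentiable_upperMellin
  have hT' := (gaussianSummable_dual hA x y hlam).differentiable_upperMellin
  have hΓ : Differentiable ℂ fun s : ℂ => (Complex.Gamma s)⁻¹ :=
    Complex.differentiable_one_div_Gamma
  have hbase : ((lam ^ 2 / Real.pi : ℝ) : ℂ) ≠ 0 :=
    Complex.ofReal_ne_zero.2 (by positivity)
  have hpow : Differentiable ℂ fun ν : ℂ => ((lam ^ 2 / Real.pi : ℝ) : ℂ) ^ (-ν / 2) := fun ν =>
    DifferentiableAt.const_cpow (by fun_prop) (.inl hbase)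
  have hhalf : Differentiable ℂ fun ν : ℂ => ν / 2 := by fun_prop
  refine ⟨fun ν => ((lam ^ 2 / Real.pi : ℝ) : ℂ) ^ (-ν / 2) *
    ((Complex.Gamma (ν / 2))⁻¹ *
      (upperMellin (directCoeff A y) (directRadius A x lam) (ν / 2) +
        ((lam ^ d / cellVolume A : ℝ) : ℂ) *
          upperMellin (dualCoeff A x y) (dualRadius A y lam) ((d - ν) / 2)) -
      zeroCoeff (directCoeff A y) (directRadius A x lam) * (Complex.Gamma (ν / 2 + 1))⁻¹),
    fun ν => ((lam ^ 2 / Real.pi : ℝ) : ℂ) ^ (-ν / 2) * ((Complex.Gamma (ν / 2))⁻¹ *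
      ((lam ^ d / cellVolume A : ℝ) : ℂ)), ?_, ?_, ?_⟩
  · exact hpow.mul (((hΓ.comp hhalf).mul ((hT.comp hhalf).add ((differentiable_const _).mul
      (hT'.comp (by fun_prop : Differentiable ℂ fun ν : ℂ => ((d : ℂ) - ν) / 2))))).sub
      ((differentiable_const _).mul
        (hΓ.comp (by fun_prop : Differentiable ℂ fun ν : ℂ => ν / 2 + 1))))
  · exact hpow.mul ((hΓ.comp hhalf).mul (differentiable_const _))
  · funext ν
    rw [regularizedCrandall]
    ring

theorem analyticAt_regularizedCrandall (hA : A.det ≠ 0) (x y : EuclideanSpace ℝ (Fin d))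
    {lam : ℝ} (hlam : 0 < lam) {ν : ℂ} (h : ¬(ν = d ∧ y ∈ reciprocalLatticeOf A)) :
    AnalyticAt ℂ (regularizedCrandall A x y lam) ν := by
  obtain ⟨D₁, D₂, h1, h2, heq⟩ := exists_differentiable_regularizedCrandall hA x y hlam
  rw [heq]
  refine (h1.analyticAt ν).add ((h2.analyticAt ν).mul ?_)
  by_cases hν : ν = d
  · simp only [zeroCoeff_dual_eq_zero hlam fun hy => h ⟨hν, hy⟩, zero_mul]
    exact analyticAt_const
  · exact analyticAt_const.mul (analyticAt_const.div (analyticAt_const.sub analyticAt_id)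
      (sub_ne_zero.2 (Ne.symm hν)))

theorem meromorphicOn_regularizedCrandall (hA : A.det ≠ 0) (x y : EuclideanSpace ℝ (Fin d))
    {lam : ℝ} (hlam : 0 < lam) : MeromorphicOn (regularizedCrandall A x y lam) Set.univ := by
  intro ν _
  obtain ⟨D₁, D₂, h1, h2, heq⟩ := exists_differentiable_regularizedCrandall hA x y hlam
  rw [heq]
  exact (h1.analyticAt ν).meromorphicAt.add ((h2.analyticAt ν).meromorphicAt.mul
    ((MeromorphicAt.const _ ν).mul ((MeromorphicAt.const _ ν).div
      (analyticAt_const.sub analyticAt_id).meromorphicAt)))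

theorem norm_epsteinTerm (x y z : EuclideanSpace ℝ (Fin d)) {ν : ℂ} (hν : 0 < ν.re) :
    ‖epsteinTerm x y ν z‖ = ‖z - x‖ ^ (-ν.re) := by
  rw [epsteinTerm, norm_div, norm_exp_neg_two_pi_I_mul, norm_sub_rev,
    Complex.norm_cpow_eq_rpow_re_of_nonneg (norm_nonneg _) hν.ne',
    Real.rpow_neg (norm_nonneg _), one_div]

theorem summable_norm_epsteinTerm (hA : A.det ≠ 0) (x y : EuclideanSpace ℝ (Fin d)) {ν : ℂ}
    (hν : (d : ℝ) < ν.re) :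
    Summable fun z : ↥(latticeOf A) => ‖epsteinTerm x y ν z‖ := by
  simp only [norm_epsteinTerm x y _ ((Nat.cast_nonneg d).trans_lt hν)]
  exact summable_latticeOf_rpow hA x hν

/-- In the half-plane of convergence the excluded term `z = x` may be included, since it is
`1 / 0 ^ ν = 0` there. -/
theorem epsteinLatticeSum_eq_tsum (x y : EuclideanSpace ℝ (Fin d)) {ν : ℂ}
    (hν : (d : ℝ) < ν.re) :
    epsteinLatticeSum A x y ν = ∑' z : ↥(latticeOf A), epsteinTerm x y ν z := by
  have hν0 : ν ≠ 0 := fun h => by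
    rw [h, Complex.zero_re] at hν
    exact hν.not_ge (Nat.cast_nonneg d)
  rw [epsteinLatticeSum, tsum_subtype (latticeOf A \ {x}) (epsteinTerm x y ν),
    tsum_subtype (latticeOf A) (epsteinTerm x y ν)]
  classical
  refine tsum_congr fun z => ?_
  by_cases hz : z = x
  · have : epsteinTerm x y ν z = 0 := by
      simp [epsteinTerm, hz, Complex.zero_cpow hν0]
    simp [Set.indicator_apply, this]
  · simp [Set.indicator_apply, hz]

/-- In the half-plane of convergence, the Mellin transform of the theta series is the completed
Epstein zeta function. -/
theorem mellin_puncturedTheta_direct (hA : A.det ≠ 0) (x y : EuclideanSpace ℝ (Fin d))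
    {lam : ℝ} (hlam : 0 < lam) {ν : ℂ} (hν : (d : ℝ) < ν.re) :
    mellin (puncturedTheta (directCoeff A y) (directRadius A x lam)) (ν / 2) =
      Complex.Gammaℝ ν * (lam : ℂ) ^ ν * epsteinLatticeSum A x y ν := by
  have hre : 0 < ν.re := (Nat.cast_nonneg d).trans_lt hν
  have hS := gaussianSummable_direct hA x y hlam
  have hr (z : ↥(latticeOf A)) : |directRadius A x lam z| =
      lam⁻¹ * ‖x - (z : EuclideanSpace ℝ (Fin d))‖ := by
    rw [abs_of_nonneg (hS.nonneg z), directRadius, norm_smul,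
      Real.norm_of_nonneg (inv_pos.2 hlam).le, norm_sub_rev]
  have hterm (z : ↥(latticeOf A)) : Complex.Gammaℝ ν * directCoeff A y z /
      ((|directRadius A x lam z| : ℝ) : ℂ) ^ ν =
        Complex.Gammaℝ ν * (lam : ℂ) ^ ν * epsteinTerm x y ν z := by
    rw [hr, Complex.ofReal_mul, Complex.mul_cpow_ofReal_nonneg (inv_pos.2 hlam).le (norm_nonneg _),
      Complex.ofReal_inv, Complex.inv_cpow _ _ (by
      rw [Complex.arg_ofReal_of_nonneg hlam.le]; exact Real.pi_ne_zero.symm), epsteinTerm,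
      directCoeff, div_eq_mul_inv, mul_inv, inv_inv]
    ring
  have key := hasSum_mellin_pi_mul_sq (a := directCoeff A y) (r := directRadius A x lam)
    (F := puncturedTheta (directCoeff A y) (directRadius A x lam)) hre
    (fun t ht => (hS.summable_puncturedGaussian ht).hasSum.congr_fun fun z => by
      unfold puncturedGaussian
      split_ifs <;> simp)
    (((summable_norm_epsteinTerm hA x y hν).mul_left (lam ^ ν.re)).congr fun z => by
      rw [hr, Real.mul_rpow (inv_pos.2 hlam).le (norm_nonneg _), Real.inv_rpow hlam.le,
        norm_epsteinTerm x y _ hre, directCoeff, norm_exp_neg_two_pi_I_mul,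
        Real.rpow_neg (norm_nonneg _), norm_sub_rev x, one_div, mul_inv, inv_inv])
  simp only [hterm] at key
  rw [← key.tsum_eq, tsum_mul_left, epsteinLatticeSum_eq_tsum x y hν]

/-- Crandall's representation in the half-plane of convergence. -/
theorem regularizedCrandall_eq_epsteinLatticeSum (hA : A.det ≠ 0)
    (x y : EuclideanSpace ℝ (Fin d)) {lam : ℝ} (hlam : 0 < lam) {ν : ℂ} (hν : (d : ℝ) < ν.re) :
    regularizedCrandall A x y lam ν = epsteinLatticeSum A x y ν := by
  have hre : 0 < ν.re := (Nat.cast_nonneg d).trans_lt hν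
  have hν0 : ν ≠ 0 := fun h => by simp [h] at hre
  have hhalf : (ν / 2).re = ν.re / 2 := by simp
  have hsplit := (gaussianSummable_direct hA x y hlam).mellin_puncturedTheta
    (gaussianSummable_dual hA x y hlam)
    (fun t ht => scaled_theta_functional_equation hA x y hlam ht) (s := ν / 2)
    (by rw [hhalf]; positivity) (by rw [hhalf]; linarith)
  rw [mellin_puncturedTheta_direct hA x y hlam hν] at hsplit
  rw [← crandallRepresentation_eq_regularizedCrandall hA x y hlam fun h => hν0 h.1,
    crandallRepresentation, (hasSum_crandallTerm hA x y hlam ν).tsum_eq,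
    (hasSum_crandallDualTerm hA x y hlam ν).tsum_eq]
  have e1 : (-2 : ℂ) / ν = -1 / (ν / 2) := by field_simp
  have e2 : ((d : ℂ) - ν) / 2 = ((d / 2 : ℝ) : ℂ) - ν / 2 := by push_cast; ring
  have e3 : (-2 : ℂ) / (d - ν) = -1 / (((d / 2 : ℝ) : ℂ) - ν / 2) := by
    rw [← e2, div_div_eq_mul_div]; norm_num
  rw [e1, e2, e3, ← hsplit]
  have hΓ : Complex.Gamma (ν / 2) ≠ 0 :=
    Complex.Gamma_ne_zero_of_re_pos (by rw [hhalf]; positivity)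
  have hlamc : (lam : ℂ) ≠ 0 := Complex.ofReal_ne_zero.2 hlam.ne'
  -- the powers of `π` and `lam` in `Gammaℝ ν * lam ^ ν` cancel the prefactor
  have hpow : ((lam ^ 2 / Real.pi : ℝ) : ℂ) ^ (-ν / 2) * (Real.pi : ℂ) ^ (-ν / 2) *
      (lam : ℂ) ^ ν = 1 := by
    rw [← Complex.mul_cpow_ofReal_nonneg (by positivity) Real.pi_pos.le, ← Complex.ofReal_mul,
      div_mul_cancel₀ _ Real.pi_ne_zero, sq, Complex.ofReal_mul,
      Complex.mul_cpow_ofReal_nonneg hlam.le hlam.le, ← Complex.cpow_add _ _ hlamc,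
      ← Complex.cpow_add _ _ hlamc, show -ν / 2 + -ν / 2 + ν = 0 by ring, Complex.cpow_zero]
  rw [Complex.Gammaℝ_def, div_mul_eq_mul_div, div_eq_iff hΓ]
  linear_combination Complex.Gamma (ν / 2) * epsteinLatticeSum A x y ν * hpow

theorem isEpsteinContinuation_toMeromorphicNFOn (hA : A.det ≠ 0)
    (x y : EuclideanSpace ℝ (Fin d)) {lam : ℝ} (hlam : 0 < lam) :
    IsEpsteinContinuation A x y
      (toMeromorphicNFOn (regularizedCrandall A x y lam) Set.univ) := by
  refine ⟨meromorphicNFOn_toMeromorphicNFOn _ _, fun ν hν => ?_⟩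
  have han := analyticAt_regularizedCrandall hA x y hlam (ν := ν) fun h => by simp [h.1] at hν
  rw [toMeromorphicNFOn_eq_toMeromorphicNFAt (meromorphicOn_regularizedCrandall hA x y hlam)
    (Set.mem_univ ν), toMeromorphicNFAt_eq_self.2 han.meromorphicNFAt,
    regularizedCrandall_eq_epsteinLatticeSum hA x y hlam hν]

theorem IsEpsteinContinuation.unique {x y : EuclideanSpace ℝ (Fin d)} {Z W : ℂ → ℂ}
    (hZ : IsEpsteinContinuation A x y Z) (hW : IsEpsteinContinuation A x y W) : Z = W := by
  have hopen : IsOpen {ν : ℂ | (d : ℝ) < ν.re} := isOpen_lt continuous_const Complex.continuous_re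
  refine hZ.1.eq_of_eventuallyEq hW.1 (z₀ := (d : ℂ) + 1) ?_
  filter_upwards [hopen.mem_nhds (x := (d : ℂ) + 1) (by simp)] with ν hν
  rw [hZ.2 ν hν, hW.2 ν hν]

/-- Away from the pole at `d`, the Epstein zeta function is the regularized representation, for
every splitting parameter. -/
theorem epsteinZeta_eventuallyEq_regularizedCrandall (hA : A.det ≠ 0)
    (x y : EuclideanSpace ℝ (Fin d)) {lam : ℝ} (hlam : 0 < lam) {ν : ℂ}
    (h : ¬(ν = d ∧ y ∈ reciprocalLatticeOf A)) :
    epsteinZeta A x y =ᶠ[𝓝 ν] regularizedCrandall A x y lam := by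
  have hcont := isEpsteinContinuation_toMeromorphicNFOn hA x y hlam
  have hZ : IsEpsteinContinuation A x y (epsteinZeta A x y) := Classical.epsilon_spec ⟨_, hcont⟩
  rw [hZ.unique hcont]
  refine (toMeromorphicNFOn_eq_toMeromorphicNFAt_on_nhds
    (meromorphicOn_regularizedCrandall hA x y hlam) (Set.mem_univ ν)).trans ?_
  rw [toMeromorphicNFAt_eq_self.2 (analyticAt_regularizedCrandall hA x y hlam h).meromorphicNFAt]

end

theorem mainTheorem1 (d : ℕ) (A : Matrix (Fin d) (Fin d) ℝ) (hA : A.det ≠ 0)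
    (x y : EuclideanSpace ℝ (Fin d)) :
    -- the Epstein zeta function is well-defined
    (∀ ν : ℂ, (d : ℝ) < ν.re →
      Summable fun z : ↥(latticeOf A \ {x}) => ‖epsteinTerm x y ν z‖) ∧
    (∃! Z : ℂ → ℂ, IsEpsteinContinuation A x y Z) ∧
    ∀ ν : ℂ, ¬ (ν = (d : ℂ) ∧ y ∈ reciprocalLatticeOf A) →
      AnalyticAt ℂ (epsteinZeta A x y) ν ∧
      -- Crandall's representation
      ∀ lam : ℝ, 0 < lam →
        SuperexponentiallyConvergent (latticeOf A) (crandallTerm x y lam ν) ∧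
        SuperexponentiallyConvergent (reciprocalLatticeOf A) (crandallDualTerm x y lam ν) ∧
        (¬ (ν = 0 ∧ x ∈ latticeOf A) →
          epsteinZeta A x y ν = crandallRepresentation A x y lam ν) ∧
        -- removable singularity of the right-hand side at `ν = 0` for `x ∈ Λ`
        (ν = 0 ∧ x ∈ latticeOf A →
          Tendsto (crandallRepresentation A x y lam) (𝓝[≠] 0) (𝓝 (epsteinZeta A x y 0))) := by
  refine ⟨fun ν hν => ?_, ⟨_, isEpsteinContinuation_toMeromorphicNFOn hA x y one_pos,
    fun Z hZ => hZ.unique (isEpsteinContinuation_toMeromorphicNFOn hA x y one_pos)⟩,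
    fun ν hν => ⟨?_, fun lam hlam => ⟨superexponentiallyConvergent_crandallTerm hA x y hlam ν,
      superexponentiallyConvergent_crandallDualTerm hA x y hlam ν, fun h0 => ?_, fun h0 => ?_⟩⟩⟩
  · have hsub : latticeOf A \ {x} ⊆ latticeOf A := Set.sdiff_subset
    have hs := (summable_norm_epsteinTerm hA x y hν).comp_injective (Set.inclusion_injective hsub)
    exact hs
  · exact (analyticAt_congr (epsteinZeta_eventuallyEq_regularizedCrandall hA x y one_pos hν)).2
      (analyticAt_regularizedCrandall hA x y one_pos hν)
  · rw [(epsteinZeta_eventuallyEq_regularizedCrandall hA x y hlam hν).eq_of_nhds,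
      crandallRepresentation_eq_regularizedCrandall hA x y hlam h0]
  · obtain ⟨rfl, -⟩ := h0
    rw [(epsteinZeta_eventuallyEq_regularizedCrandall hA x y hlam hν).eq_of_nhds]
    refine ((analyticAt_regularizedCrandall hA x y hlam hν).continuousAt.tendsto.mono_left
      nhdsWithin_le_nhds).congr' ?_
    filter_upwards [self_mem_nhdsWithin] with w hw
    exact (crandallRepresentation_eq_regularizedCrandall hA x y hlam fun h => hw h.1).symm
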